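/- All graphs are finite and simple. A realisation of a graph $G$ is a map $p\colon V(G)\to\mathbb{R}^2$; it is generic if its $2|V(G)|$ coordinates are algebraically independent over $\mathbb{Q}$. A continuous motion of $(G,p)$ is a continuous map $\phi\colon(-1,1)\times V(G)\to\mathbb{R}^2$, $\phi_t=\phi(t,\cdot)$, with $\phi_0=p$ and $\lVert\phi_t(u)-\phi_t(v)\rVert=\lVert p(u)-p(v)\rVert$ for all $t\in(-1,1)$ and all edges $uv$; it is trivial if this equality holds for all $t\in(-1,1)$ and all pairs of vertices $u,v$. The realisation $(G,p)$ is flexible if it has a nontrivial continuous motion, and rigid otherwise. A graph is rigid if all its generic realisations are rigid, and flexible otherwise. The rigid components of $G$ are its maximal rigid subgraphs. A graph is $2$-connected if it has at least three vertices, is connected, and remains connected after the deletion of any single vertex. For $E'\subseteq E(G)$, let $G[E']$ be the subgraph whose edges are those in $E'$ and whose vertices are the ends of these edges. A stable separation of $G$ is an unordered pair $\{G_1,G_2\}$ of subgraphs for which there is a partition $\{E_1,E_2\}$ of $E(G)$ with $G_1=G[E_1]$ and $G_2=G[E_2]$, such that $V(G_1)\setminus V(G_2)\neq\varnothing$, $V(G_2)\setminus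 V(G_1)\neq\varnothing$, and no two vertices of $V(G_1)\cap V(G_2)$ are adjacent in $G$. A NAC-colouring of $G$ is a surjective map $c\colon E(G)\to\{\mathrm{red},\mathrm{blue}\}$ such that every cycle of $G$ either is monochromatic or contains at least two red and at least two blue edges. Let $\nu(G)$ be the number of NAC-colourings of $G$ divided by $2$. Theorem. Let $G$ be a $2$-connected flexible graph with $\ell$ rigid components. Then $G$ has at least $\lceil\log_2\ell\rceil$ stable separations, $\nu(G)\ge\lceil\log_2\ell\rceil$, and $\nu(G)\ge 3$. -/

import Mathlib

namespace FlexGraph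

/-- The Euclidean plane. -/
abbrev Plane : Type := EuclideanSpace ℝ (Fin 2)

section Rigidity

/-- A realisation `p : V → ℝ²` is generic if the family of all its `2|V|` coordinates is
algebraically independent over `ℚ`. -/
def IsGeneric {V : Type*} (p : V → Plane) : Prop :=
  AlgebraicIndependent ℚ (fun x : V × Fin 2 => p x.1 x.2)

/-- Two realisations of `G` are equivalent if they give the same length to every edge. -/
def Equivalent {V : Type*} (G : SimpleGraph V) (p q : V → Plane) : Prop :=
  ∀ u v : V, G.Adj u v → dist (p u) (p v) = dist (q u) (q v)

/-- `φ` is a continuous motion of `(G, p)`, with time parameter in `(-1, 1)`. (The values of `φ`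
outside this interval play no role.) -/
structure IsContinuousMotion {V : Type*} (G : SimpleGraph V) (p : V → Plane)
    (φ : ℝ → V → Plane) : Prop where
  continuousOn : ContinuousOn φ (Set.Ioo (-1 : ℝ) 1)
  start : φ 0 = p
  equivalent : ∀ t ∈ Set.Ioo (-1 : ℝ) 1, Equivalent G p (φ t)

/-- A motion is trivial if `p` and `φ t` are congruent (all pairwise distances agree) for every
`t` in `(-1, 1)`. -/
def IsTrivialMotion {V : Type*} (p : V → Plane) (φ : ℝ → V → Plane) : Prop :=
  ∀ t ∈ Set.Ioo (-1 : ℝ) 1, Congruent p (φ t)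

/-- The realisation `(G, p)` is flexible if it has a nontrivial continuous motion. -/
def IsFlexibleRealisation {V : Type*} (G : SimpleGraph V) (p : V → Plane) : Prop :=
  ∃ φ : ℝ → V → Plane, IsContinuousMotion G p φ ∧ ¬ IsTrivialMotion p φ

/-- The realisation `(G, p)` is rigid if it is not flexible. -/
def IsRigidRealisation {V : Type*} (G : SimpleGraph V) (p : V → Plane) : Prop :=
  ¬ IsFlexibleRealisation G p

/-- A graph is rigid (in the plane) if its generic realisations are rigid. -/
def IsRigid {V : Type*} (G : SimpleGraph V) : Prop :=
  ∀ p : V → Plane, IsGeneric p → IsRigidRealisation G p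

/-- A graph is flexible (in the plane) if it is not rigid, that is, if it has a flexible generic
realisation. As rigidity of generic realisations depends only on the graph, it is the same to ask
that all generic realisations are flexible; what is required here is formally the least. -/
def IsFlexible {V : Type*} (G : SimpleGraph V) : Prop :=
  ¬ IsRigid G

/-- The rigid components of `G` are its maximal rigid subgraphs. -/
def IsRigidComponent {V : Type*} (G : SimpleGraph V) (R : G.Subgraph) : Prop :=
  Maximal (fun H : G.Subgraph => IsRigid H.coe) R

/-- The number of rigid components of `G`. -/
noncomputable def numRigidComponents {V : Type*} (G : SimpleGraph V) : ℕ :=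
  Set.ncard {R : G.Subgraph | IsRigidComponent G R}

end Rigidity

/-- `G` is 2-connected: it has at least three vertices, it is connected, and it stays connected
after the deletion of any one vertex. -/
structure IsTwoConnected {V : Type*} (G : SimpleGraph V) : Prop where
  three_le_card : 3 ≤ Nat.card V
  connected : G.Connected
  connected_delete : ∀ v : V, (G.induce {v}ᶜ).Connected

section Separations

/-- The edge-induced subgraph `G[E]`: its edges are the edges of `G` in `E`, and its vertices are
the ends of these edges. -/
def edgeInduced {V : Type*} (G : SimpleGraph V) (E : Set (Sym2 V)) : G.Subgraph where
  verts := {v | ∃ w, G.Adj v w ∧ s(v, w) ∈ E}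
  Adj u v := G.Adj u v ∧ s(u, v) ∈ E
  adj_sub h := h.1
  edge_vert {_ w} h := ⟨w, h⟩
  symm := ⟨fun _ _ h => ⟨h.1.symm, Sym2.eq_swap ▸ h.2⟩⟩

/-- `{G₁, G₂}` is a separation of `G`. The two classes of the partition `{E₁, E₂}` of `E(G)` are
nonempty because each of `G₁`, `G₂` is required to have a vertex that is not in the other. -/
def IsSeparation {V : Type*} (G : SimpleGraph V) (G₁ G₂ : G.Subgraph) : Prop :=
  (∃ E₁ E₂ : Set (Sym2 V), E₁ ∪ E₂ = G.edgeSet ∧ Disjoint E₁ E₂ ∧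
    G₁ = edgeInduced G E₁ ∧ G₂ = edgeInduced G E₂) ∧
  (G₁.verts \ G₂.verts).Nonempty ∧ (G₂.verts \ G₁.verts).Nonempty

/-- The separation `{G₁, G₂}` is stable if `V(G₁ ∩ G₂)` is a stable set of `G`. -/
def IsStableSeparation {V : Type*} (G : SimpleGraph V) (G₁ G₂ : G.Subgraph) : Prop :=
  IsSeparation G G₁ G₂ ∧ G.IsIndepSet (G₁ ⊓ G₂).verts

/-- The number of stable separations of `G`, counted as unordered pairs `{G₁, G₂}`. -/
noncomputable def numStableSeparations {V : Type*} (G : SimpleGraph V) : ℕ :=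
  Set.ncard {P : Sym2 G.Subgraph | ∃ G₁ G₂ : G.Subgraph, P = s(G₁, G₂) ∧
    IsStableSeparation G G₁ G₂}

end Separations

section NAC

/-- The two colours. -/
inductive Colour where
  | red
  | blue

/-- The set of edges of colour `a` on the closed walk `w`. -/
def colouredEdges {V : Type*} {G : SimpleGraph V} (c : G.edgeSet → Colour) {v : V}
    (w : G.Walk v v) (a : Colour) : Set G.edgeSet :=
  {e | (e : Sym2 V) ∈ w.edges ∧ c e = a}

/-- A NAC-colouring is a surjective edge colouring with colours red and blue such that every
cycle is monochromatic or has at least two red and at least two blue edges. -/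
def IsNACColouring {V : Type*} (G : SimpleGraph V) (c : G.edgeSet → Colour) : Prop :=
  Function.Surjective c ∧
  ∀ (v : V) (w : G.Walk v v), w.IsCycle →
    (∃ a : Colour, ∀ e : G.edgeSet, (e : Sym2 V) ∈ w.edges → c e = a) ∨
    (2 ≤ (colouredEdges c w Colour.red).ncard ∧ 2 ≤ (colouredEdges c w Colour.blue).ncard)

/-- `ν(G)`: the number of NAC-colourings of `G`, divided by two. -/
noncomputable def nu {V : Type*} (G : SimpleGraph V) : ℚ :=
  (Set.ncard {c : G.edgeSet → Colour | IsNACColouring G c} : ℚ) / 2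

end NAC

end FlexGraph

/-! The argument replaces the flexible graph by a hypergraph of rigid bodies. Take a maximal edge
set satisfying Laman's sparsity count; the bodies are its maximal tight vertex sets. They cover all
edges, induce rigid subgraphs, meet pairwise in at most one vertex, and no three of them form a
triangle. The whole vertex set is not a body, since the graph is flexible (`exists_isBodySystem`).

Rigidity of the bodies is the hard direction of Laman's theorem: sparse edge sets are built by
Henneberg moves, so they carry no self-stress at generic points (`IsSparse.independent_of_card_le`),
and then a dimension count and an open-closed argument along a motion give rigidity
(`isRigid_of_isSparse`). Conversely, rigid subgraphs with two common vertices glue to a rigid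
subgraph (`IsRigid.sup`), so every rigid component contains a body and no two contain the same one.
Hence `ℓ` is at most the number of bodies.

The combinatorial core is `exists_isStableSide`: a vertex `u` is separated from a tight set `D` by a
stable set unless one tight set contains both. If all bodies at `u` are pairs, the neighbours of `u`
form the stable set, because there are no triangles. Otherwise a vertex of a larger body is merged
into `u`, and induction applies; the merged vertex can be chosen so that sparsity holds and `u` and
`D` stay apart (`IsSaturated.exists_merge`).

So any two bodies lie on opposite sides of some stable separation. Recording for each body which
separations have it on the first side embeds the bodies into the subsets of the set of stable
separations, which gives the logarithmic bound. Each stable separation yields two NAC-colourings,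
one for each choice of the red side.

For `ν ≥ 3`, 2-connectedness forces at least four bodies. Five or more bodies already give three
separations. With exactly four, each of the six ways to colour two bodies red and two blue is a
NAC-colouring. -/

namespace FlexGraph

/-! ### Sparse systems of bodies and stable sets separating them. -/

section SparseSystems

open Finset

variable {V : Type*} [DecidableEq V]

/-- The count of a system of bodies on a vertex set `X`: a body meeting `X` in `k ≥ 2` vertices
contributes `2 * k - 3`, the rank of a rigid graph on `k` vertices. -/
def spread (𝓒 : Finset (Finset V)) (X : Finset V) : ℕ := ∑ C ∈ 𝓒, (2 * #(C ∩ X) - 3)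

/-- The system satisfies Laman's sparsity condition. -/
def IsSparse (𝓒 : Finset (Finset V)) : Prop :=
  ∀ X : Finset V, 2 ≤ #X → spread 𝓒 X + 3 ≤ 2 * #X

/-- Equality holds at `X` in the sparsity condition. -/
def IsTight (𝓒 : Finset (Finset V)) (X : Finset V) : Prop :=
  2 ≤ #X ∧ spread 𝓒 X + 3 = 2 * #X

/-- A sparse system of nontrivial bodies in which every tight set lies in a body. -/
structure IsSaturated (𝓒 : Finset (Finset V)) : Prop where
  sparse : IsSparse 𝓒
  two_le_card : ∀ C ∈ 𝓒, 2 ≤ #C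
  exists_superset : ∀ X, IsTight 𝓒 X → ∃ C ∈ 𝓒, X ⊆ C

lemma spread_mono_left {𝓒 𝓓 : Finset (Finset V)} (h : 𝓒 ⊆ 𝓓) (X : Finset V) :
    spread 𝓒 X ≤ spread 𝓓 X :=
  sum_le_sum_of_subset h

lemma spread_mono_right (𝓒 : Finset (Finset V)) {X Y : Finset V} (h : X ⊆ Y) :
    spread 𝓒 X ≤ spread 𝓒 Y := by
  refine sum_le_sum fun C _ => ?_
  have := card_le_card (inter_subset_inter_left (s := C) h)
  omega

/-- Supermodularity: the truncated function `k ↦ 2 * k - 3` is convex, and the sizes of the traces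
on `X ∪ Y` and `X ∩ Y` have the same sum as those on `X` and `Y` but lie further apart. -/
lemma spread_add_spread_le (𝓒 : Finset (Finset V)) (X Y : Finset V) :
    spread 𝓒 X + spread 𝓒 Y ≤ spread 𝓒 (X ∪ Y) + spread 𝓒 (X ∩ Y) := by
  unfold spread
  rw [← sum_add_distrib, ← sum_add_distrib]
  refine sum_le_sum fun C _ => ?_
  have h1 := card_union_add_card_inter (C ∩ X) (C ∩ Y)
  rw [← inter_union_distrib_left, ← inter_inter_distrib_left] at h1
  have h2 := card_le_card (inter_subset_inter_left (s := C) (inter_subset_left (s₁ := X) (s₂ := Y)))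
  have h3 := card_le_card (inter_subset_inter_left (s := C) (inter_subset_right (s₁ := X) (s₂ := Y)))
  omega

/-- At a body which meets `X`, `Y` in two vertices each and `X ∩ Y` in one vertex the
supermodular inequality is strict. -/
lemma spread_add_spread_lt {𝓒 : Finset (Finset V)} {X Y Q : Finset V} (hQ : Q ∈ 𝓒)
    (hX : #(Q ∩ X) = 2) (hY : #(Q ∩ Y) = 2) (hXY : #(Q ∩ (X ∩ Y)) ≤ 1) :
    spread 𝓒 X + spread 𝓒 Y < spread 𝓒 (X ∪ Y) + spread 𝓒 (X ∩ Y) := by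
  have h0 := spread_add_spread_le (𝓒.erase Q) X Y
  unfold spread at *
  rw [← add_sum_erase 𝓒 _ hQ, ← add_sum_erase 𝓒 _ hQ, ← add_sum_erase 𝓒 _ hQ,
    ← add_sum_erase 𝓒 _ hQ]
  have h1 := card_union_add_card_inter (Q ∩ X) (Q ∩ Y)
  rw [← inter_union_distrib_left, ← inter_inter_distrib_left] at h1
  omega

lemma IsSparse.mono {𝓒 𝓓 : Finset (Finset V)} (h : 𝓒 ⊆ 𝓓) (hs : IsSparse 𝓓) : IsSparse 𝓒 :=
  fun X hX => (Nat.add_le_add_right (spread_mono_left h X) 3).trans (hs X hX)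

lemma IsTight.of_le {𝓒 : Finset (Finset V)} (hs : IsSparse 𝓒) {X : Finset V} (hX : 2 ≤ #X)
    (h : 2 * #X ≤ spread 𝓒 X + 3) : IsTight 𝓒 X :=
  ⟨hX, le_antisymm (hs X hX) h⟩

lemma le_spread_of_mem {𝓒 : Finset (Finset V)} {C : Finset V} (hC : C ∈ 𝓒) (X : Finset V) :
    2 * #(C ∩ X) - 3 ≤ spread 𝓒 X :=
  single_le_sum (f := fun C => 2 * #(C ∩ X) - 3) (fun _ _ => Nat.zero_le _) hC

lemma isTight_of_subset_mem {𝓒 : Finset (Finset V)} (hs : IsSparse 𝓒) {C X : Finset V}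
    (hC : C ∈ 𝓒) (hX : 2 ≤ #X) (h : X ⊆ C) : IsTight 𝓒 X := by
  refine .of_le hs hX ?_
  have := le_spread_of_mem hC X
  rw [inter_eq_right.2 h] at this
  omega

/-- Uncrossing: supermodularity together with sparsity of `X ∩ Y`, which needs its two vertices,
leaves no slack at the union. -/
lemma IsTight.union {𝓒 : Finset (Finset V)} (hs : IsSparse 𝓒) {X Y : Finset V}
    (hX : IsTight 𝓒 X) (hY : IsTight 𝓒 Y) (h : 2 ≤ #(X ∩ Y)) : IsTight 𝓒 (X ∪ Y) := by
  have h1 := hs _ h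
  have h2 := spread_add_spread_le 𝓒 X Y
  have h3 := card_union_add_card_inter X Y
  have h4 := card_le_card (subset_union_left (s₁ := X) (s₂ := Y))
  exact .of_le hs (by have := hX.1; omega) (by have := hX.2; have := hY.2; omega)

lemma spread_inter {𝓒 : Finset (Finset V)} {N : Finset V} (hN : ∀ C ∈ 𝓒, C ⊆ N) (X : Finset V) :
    spread 𝓒 (X ∩ N) = spread 𝓒 X := by
  refine sum_congr rfl fun C hC => ?_
  rw [inter_comm X N, ← inter_assoc, inter_eq_left.2 (hN C hC)]

lemma spread_eq_zero_of_card_le_one (𝓒 : Finset (Finset V)) {X : Finset V} (h : #X ≤ 1) :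
    spread 𝓒 X = 0 := by
  refine sum_eq_zero fun C _ => ?_
  have := card_le_card (inter_subset_right (s₁ := C) (s₂ := X))
  omega

/-- Discarding vertices outside all bodies keeps the spread and lowers `2 * #X`, which a tight set
does not allow. -/
lemma IsTight.subset {𝓒 : Finset (Finset V)} (hs : IsSparse 𝓒) {N : Finset V}
    (hN : ∀ C ∈ 𝓒, C ⊆ N) {X : Finset V} (hX : IsTight 𝓒 X) : X ⊆ N := by
  have h1 := spread_inter hN X
  have h2 := hX.1
  have h3 := hX.2
  rw [← inter_eq_left]
  refine eq_of_subset_of_card_le inter_subset_left ?_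
  by_cases h : 2 ≤ #(X ∩ N)
  · have := hs _ h
    omega
  · have := spread_eq_zero_of_card_le_one 𝓒 (X := X ∩ N) (by omega)
    omega

/-- Two bodies with `k ≥ 2` common vertices would contribute `2 * (2 * k - 3)` to a set of size `k`,
which exceeds `2 * k - 3`. -/
lemma IsSaturated.card_inter_le_one {𝓒 : Finset (Finset V)} (h : IsSaturated 𝓒)
    {C D : Finset V} (hC : C ∈ 𝓒) (hD : D ∈ 𝓒) (hCD : C ≠ D) : #(C ∩ D) ≤ 1 := by
  by_contra! hlt
  have h1 := h.sparse _ hlt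
  have h2 := spread_mono_left (𝓒 := {C, D}) (𝓓 := 𝓒)
    (by simp [insert_subset_iff, hC, hD]) (C ∩ D)
  rw [spread, sum_pair hCD, ← inter_assoc, inter_self, inter_comm C D, ← inter_assoc,
    inter_self, inter_comm D C] at h2
  omega

lemma IsSaturated.eq_of_mem {𝓒 : Finset (Finset V)} (h : IsSaturated 𝓒)
    {C D : Finset V} (hC : C ∈ 𝓒) (hD : D ∈ 𝓒) {x y : V} (hxy : x ≠ y) (hxC : x ∈ C) (hyC : y ∈ C)
    (hxD : x ∈ D) (hyD : y ∈ D) : C = D := by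
  by_contra hCD
  have := h.card_inter_le_one hC hD hCD
  exact hxy (card_le_one.1 this x (by simp [*]) y (by simp [*]))

/-- Three bodies of a saturated system do not form a triangle. -/
lemma IsSaturated.no_triangle {𝓒 : Finset (Finset V)} (h : IsSaturated 𝓒)
    {C D F : Finset V} (hC : C ∈ 𝓒) (hD : D ∈ 𝓒) (hF : F ∈ 𝓒) {x y z : V}
    (hxy : x ≠ y) (hyz : y ≠ z) (hxC : x ∈ C) (hxD : x ∈ D) (hyC : y ∈ C)
    (hyF : y ∈ F) (hzD : z ∈ D) (hzF : z ∈ F) (hCD : C ≠ D) : C = F := by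
  by_contra hCF
  have hDF : D ≠ F := fun e => hxy <| by
    subst e
    by_contra hne
    exact hCD (h.eq_of_mem hC hD hne hxC hyC hxD hyF)
  have hyD : y ∉ D := fun hyD => hCD (h.eq_of_mem hC hD hxy hxC hyC hxD hyD)
  -- The three bodies have total size at least three more than their union, so their contributions
  -- `2 * (#C + #D + #F) - 9` make the union tight. By saturation it then lies in a single body.
  have hsum := spread_mono_left (𝓒 := {C, D, F}) (𝓓 := 𝓒)
    (by simp [insert_subset_iff, hC, hD, hF]) (C ∪ D ∪ F)
  rw [spread, sum_insert (by simp [hCD, hCF]), sum_pair hDF,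
    inter_eq_left.2 (subset_union_left.trans subset_union_left),
    inter_eq_left.2 (subset_union_right.trans subset_union_left),
    inter_eq_left.2 subset_union_right] at hsum
  have h1 := card_union_add_card_inter C D
  have h2 := card_union_add_card_inter (C ∪ D) F
  have h3 : 0 < #(C ∩ D) := card_pos.2 ⟨x, by simp [*]⟩
  have h4 : 2 ≤ #((C ∪ D) ∩ F) := by
    rw [← card_pair hyz]
    exact card_le_card (by simp [insert_subset_iff, *])
  have h5 := h.two_le_card C hC
  have h6 := h.two_le_card D hD
  have h7 := h.two_le_card F hF
  have h8 := card_le_card (subset_union_left (s₁ := C ∪ D) (s₂ := F))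
  have h9 := card_le_card (subset_union_left (s₁ := C) (s₂ := D))
  obtain ⟨R, hR, hsub⟩ := h.exists_superset _
    (IsTight.of_le h.sparse (X := C ∪ D ∪ F) (by omega) (by omega))
  have e1 : C = R := h.eq_of_mem hC hR hxy hxC hyC (hsub (by simp [*])) (hsub (by simp [*]))
  have e2 : F = R := h.eq_of_mem hF hR hyz hyF hzF (hsub (by simp [*])) (hsub (by simp [*]))
  exact hCF (e1.trans e2.symm)

lemma card_union_biUnion_le (Y : Finset V) (𝓡 : Finset (Finset V)) :
    #(Y ∪ 𝓡.biUnion id) + ∑ R ∈ 𝓡, #(R ∩ Y) ≤ #Y + ∑ R ∈ 𝓡, #R := by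
  have h1 : Y ∪ 𝓡.biUnion id = Y ∪ 𝓡.biUnion (fun R => R \ Y) := by
    ext x
    simp only [mem_union, mem_biUnion, id, mem_sdiff]
    constructor
    · rintro (h | ⟨R, hR, hx⟩)
      · exact Or.inl h
      · by_cases hxY : x ∈ Y
        · exact Or.inl hxY
        · exact Or.inr ⟨R, hR, hx, hxY⟩
    · rintro (h | ⟨R, hR, hx, -⟩)
      · exact Or.inl h
      · exact Or.inr ⟨R, hR, hx⟩
  have h2 : ∑ R ∈ 𝓡, #(R \ Y) + ∑ R ∈ 𝓡, #(R ∩ Y) = ∑ R ∈ 𝓡, #R := by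
    rw [← sum_add_distrib]
    exact sum_congr rfl fun R _ => card_sdiff_add_card_inter R Y
  rw [h1]
  have h3 := card_union_le Y (𝓡.biUnion (fun R => R \ Y))
  have h4 := card_biUnion_le (s := 𝓡) (t := fun R => R \ Y)
  omega

/-! ### Saturating a sparse system by its maximal tight sets. -/

section Components

variable [Fintype V]

open Classical in
/-- The maximal tight sets of a system. -/
noncomputable def components (𝓒 : Finset (Finset V)) : Finset (Finset V) :=
  univ.filter (Maximal (IsTight 𝓒))

lemma mem_components {𝓒 : Finset (Finset V)} {X : Finset V} :
    X ∈ components 𝓒 ↔ Maximal (IsTight 𝓒) X := by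
  simp [components]

lemma exists_mem_components {𝓒 : Finset (Finset V)} {X : Finset V} (hX : IsTight 𝓒 X) :
    ∃ R ∈ components 𝓒, X ⊆ R := by
  obtain ⟨R, hXR, hR⟩ := (Set.toFinite {Y | IsTight 𝓒 Y}).exists_le_maximal hX
  exact ⟨R, mem_components.2 hR, hXR⟩

lemma card_inter_le_one_of_mem_components {𝓒 : Finset (Finset V)} (hs : IsSparse 𝓒)
    {R T : Finset V} (hR : R ∈ components 𝓒) (hT : T ∈ components 𝓒) (h : R ≠ T) :
    #(R ∩ T) ≤ 1 := by
  rw [mem_components] at hR hT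
  by_contra! hlt
  have hu := hR.1.union hs hT.1 hlt
  exact h ((hR.eq_of_le hu subset_union_left).trans (hT.eq_of_le hu subset_union_right).symm)

/-- Bodies lying in distinct components are counted separately. -/
lemma sum_spread_le {𝓒 : Finset (Finset V)} (hs : IsSparse 𝓒) {𝓡 : Finset (Finset V)}
    (h𝓡 : 𝓡 ⊆ components 𝓒) {Z : Finset V} (hZ : ∀ R ∈ 𝓡, R ⊆ Z) :
    ∑ R ∈ 𝓡, spread 𝓒 R ≤ spread 𝓒 Z := by
  unfold spread
  rw [sum_comm]
  refine sum_le_sum fun C hC => ?_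
  by_cases h2 : 2 ≤ #C
  -- A body is tight, hence inside one component `R₀`; it meets every other component in at most one
  -- vertex and contributes nothing there.
  · obtain ⟨R₀, hR₀, hsub⟩ := exists_mem_components (isTight_of_subset_mem hs hC h2 subset_rfl)
    have hz : ∀ R ∈ 𝓡, R ≠ R₀ → 2 * #(C ∩ R) - 3 = 0 := fun R hR hne => by
      have h1 := card_inter_le_one_of_mem_components hs hR₀ (h𝓡 hR) hne.symm
      have h3 := card_le_card (inter_subset_inter_right (u := R) hsub)
      omega
    by_cases hmem : R₀ ∈ 𝓡
    · rw [sum_eq_single R₀ hz (fun h => absurd hmem h)]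
      have := card_le_card (inter_subset_inter_left (s := C) (hZ R₀ hmem))
      omega
    · rw [sum_eq_zero fun R hR => hz R hR (ne_of_mem_of_not_mem hR hmem)]
      exact Nat.zero_le _
  · rw [sum_eq_zero fun R hR => ?_]
    · exact Nat.zero_le _
    · have := card_le_card (inter_subset_left (s₁ := C) (s₂ := R))
      omega

/-- The sparsity count for the components, with the tight set that equality produces. -/
lemma exists_spread_components_le {𝓒 : Finset (Finset V)} (hs : IsSparse 𝓒) (Y : Finset V) : ∃ Z, Y ⊆ Z ∧
      spread (components 𝓒) Y + 2 * #Z ≤ 2 * #Y + spread 𝓒 Z := by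
  -- `Z` absorbs all components that meet `Y` in two vertices. Each such `R` adds at most `#(R \ Y)`
  -- vertices, and its tightness pays for them: `2 * #(R ∩ Y) - 3` equals `spread 𝓒 R - 2 * #(R \
  -- Y)`.
  set 𝓡 := (components 𝓒).filter (fun R => 2 ≤ #(R ∩ Y)) with h𝓡
  refine ⟨Y ∪ 𝓡.biUnion id, subset_union_left, ?_⟩
  have h1 : spread (components 𝓒) Y + ∑ R ∈ 𝓡, 3 = ∑ R ∈ 𝓡, 2 * #(R ∩ Y) := by
    rw [spread, ← sum_filter_add_sum_filter_not (components 𝓒) (fun R => 2 ≤ #(R ∩ Y)),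
      sum_eq_zero (s := (components 𝓒).filter (fun R => ¬ 2 ≤ #(R ∩ Y))), add_zero,
      ← sum_add_distrib]
    · refine sum_congr rfl fun R hR => ?_
      have := (mem_filter.1 hR).2
      omega
    · intro R hR
      have := (mem_filter.1 hR).2
      omega
  have h2 := card_union_biUnion_le Y 𝓡
  have h3 := sum_spread_le hs (𝓡 := 𝓡) (Z := Y ∪ 𝓡.biUnion id) (filter_subset _ _)
    (fun R hR => (subset_biUnion_of_mem id hR).trans subset_union_right)
  have h4 : ∑ R ∈ 𝓡, spread 𝓒 R + ∑ R ∈ 𝓡, 3 = ∑ R ∈ 𝓡, 2 * #R := by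
    rw [← sum_add_distrib]
    exact sum_congr rfl fun R hR => (mem_components.1 (mem_filter.1 hR).1).1.2
  rw [← mul_sum] at h1 h4
  omega

/-- The slack of the components at `Y` is at least the slack of `𝓒` at the enlarged set `Z`.
Equality at `Y` therefore makes `Z` tight, and a component contains it. -/
lemma isSaturated_components {𝓒 : Finset (Finset V)} (hs : IsSparse 𝓒) :
    IsSaturated (components 𝓒) where
  sparse Y hY := by
    obtain ⟨Z, hYZ, h⟩ := exists_spread_components_le hs Y
    have := hs Z (hY.trans (card_le_card hYZ))
    omega
  two_le_card C hC := (mem_components.1 hC).1.1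
  exists_superset Y hY := by
    obtain ⟨Z, hYZ, h⟩ := exists_spread_components_le hs Y
    have := hY.2
    obtain ⟨R, hR, hZR⟩ := exists_mem_components
      (IsTight.of_le hs (X := Z) (hY.1.trans (card_le_card hYZ)) (by omega))
    exact ⟨R, hR, hYZ.trans hZR⟩

end Components

/-! ### Merging two vertices of a body. -/

section Contraction

/-- The image of a body when the vertex `q` is merged into `u`. -/
def merge (u q : V) (C : Finset V) : Finset V :=
  if q ∈ C then insert u (C.erase q) else C

/-- Only an inequality, as distinct bodies may acquire the same image. -/
lemma sum_card_merge_inter_le {𝓒 : Finset (Finset V)} (X : Finset V) (u q : V) :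
    spread (𝓒.image (merge u q)) X ≤ ∑ C ∈ 𝓒, (2 * #(merge u q C ∩ X) - 3) :=
  sum_image_le_of_nonneg (f := fun C => 2 * #(C ∩ X) - 3) (by intros; exact Nat.zero_le _)

lemma merge_subset {u q : V} (C : Finset V) : C.erase q ⊆ merge u q C := by
  unfold merge
  split_ifs
  · exact subset_insert _ _
  · exact erase_subset _ _

lemma not_mem_merge {u q : V} (h : u ≠ q) (C : Finset V) : q ∉ merge u q C := by
  unfold merge
  split_ifs with hq
  · simp [h.symm]
  · exact hq

lemma card_merge_inter {u q : V} {C X : Finset V} (huX : u ∈ X) (hqX : q ∉ X)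
    (hC : ¬ (u ∈ C ∧ q ∈ C)) : #(merge u q C ∩ X) = #(C ∩ insert q X) := by
  unfold merge
  split_ifs with hq
  · have hu : u ∉ C := fun hu => hC ⟨hu, hq⟩
    rw [insert_inter_of_mem huX, inter_insert_of_mem hq,
      card_insert_of_notMem (by simp [hu]), card_insert_of_notMem (by simp [hqX]),
      erase_inter, erase_eq_of_notMem (by simp [hqX])]
  · rw [inter_insert_of_notMem hq]

lemma card_merge_inter_of_mem {u q : V} (huq : u ≠ q) {C X : Finset V} (hqX : q ∉ X)
    (hu : u ∈ C) (hq : q ∈ C) : #(merge u q C ∩ X) + 1 = #(C ∩ insert q X) := by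
  unfold merge
  rw [if_pos hq, insert_eq_of_mem (by simp [hu, huq]), inter_insert_of_mem hq,
      card_insert_of_notMem (by simp [hqX]), erase_inter, erase_eq_of_notMem (by simp [hqX])]

/-- Merging `q` into `u` inside a body `Q` changes only the contribution of `Q`. -/
lemma sum_merge {𝓒 : Finset (Finset V)} (h : IsSaturated 𝓒) {Q X : Finset V} {u q : V}
    (hQ : Q ∈ 𝓒) (hu : u ∈ Q) (hq : q ∈ Q) (huq : u ≠ q) (huX : u ∈ X) (hqX : q ∉ X) :
    ∑ C ∈ 𝓒, (2 * #(merge u q C ∩ X) - 3) + (2 * #(Q ∩ insert q X) - 3) =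
      spread 𝓒 (insert q X) + (2 * #(Q ∩ insert q X) - 5) := by
  rw [spread, ← add_sum_erase 𝓒 _ hQ, ← add_sum_erase 𝓒 (fun C => 2 * #(C ∩ insert q X) - 3) hQ]
  have h1 := card_merge_inter_of_mem huq hqX hu hq
  have h2 : ∑ C ∈ 𝓒.erase Q, (2 * #(merge u q C ∩ X) - 3) =
      ∑ C ∈ 𝓒.erase Q, (2 * #(C ∩ insert q X) - 3) := by
    refine sum_congr rfl fun C hC => ?_
    rw [mem_erase] at hC
    rw [card_merge_inter huX hqX]
    rintro ⟨h3, h4⟩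
    exact hC.1 (h.eq_of_mem hC.2 hQ huq h3 h4 hu hq)
  rw [h2]
  have h3 : 2 ≤ #(Q ∩ insert q X) := by
    rw [← card_pair huq]
    exact card_le_card (by simp [insert_subset_iff, *])
  omega

/-- Compare `X ∋ u` with `insert q X`. Twice the size drops by 2, and the contribution of `Q` drops
by 2 if `Q` meets `insert q X` in three vertices, but only by 1 if it meets it in `u` and `q` alone.
The second case is harmful only if `insert q X` is tight; saturation would then put it inside `Q`,
where it has at least three vertices. -/
lemma IsSaturated.isSparse_merge {𝓒 : Finset (Finset V)} (h : IsSaturated 𝓒) {Q : Finset V}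
    {u q : V} (hQ : Q ∈ 𝓒) (hu : u ∈ Q) (hq : q ∈ Q) (huq : u ≠ q) :
    IsSparse (𝓒.image (merge u q)) := by
  -- it is enough to consider vertex sets avoiding `q`
  have key : ∀ X : Finset V, 2 ≤ #X → q ∉ X → spread (𝓒.image (merge u q)) X + 3 ≤ 2 * #X := by
    intro X hX hqX
    have h0 := sum_card_merge_inter_le (𝓒 := 𝓒) X u q
    by_cases huX : u ∈ X
    · have h1 := sum_merge h hQ hu hq huq huX hqX
      have h2 : #(insert q X) = #X + 1 := card_insert_of_notMem hqX
      have h3 := h.sparse (insert q X) (by omega)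
      have h4 : 2 ≤ #(Q ∩ insert q X) := by
        rw [← card_pair huq]
        exact card_le_card (by simp [insert_subset_iff, *])
      by_cases h5 : 3 ≤ #(Q ∩ insert q X)
      · omega
      · by_cases h6 : IsTight 𝓒 (insert q X)
        · obtain ⟨R, hR, hsub⟩ := h.exists_superset _ h6
          have hRQ : R = Q := h.eq_of_mem hR hQ huq (hsub (by simp [huX])) (hsub (by simp)) hu hq
          rw [hRQ] at hsub
          rw [inter_eq_right.2 hsub] at h5
          omega
        · have : spread 𝓒 (insert q X) + 3 ≠ 2 * #(insert q X) := fun e => h6 ⟨by omega, e⟩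
          omega
    · refine le_trans (Nat.add_le_add_right (h0.trans ?_) 3) (h.sparse X hX)
      refine sum_le_sum fun C _ => ?_
      have : merge u q C ∩ X ⊆ C ∩ X := by
        unfold merge
        split_ifs
        · rw [insert_inter_of_notMem huX]
          exact inter_subset_inter_right (erase_subset _ _)
        · exact subset_rfl
      have := card_le_card this
      omega
  intro X hX
  by_cases hqX : q ∈ X
  · have h1 : spread (𝓒.image (merge u q)) (X.erase q) = spread (𝓒.image (merge u q)) X := by
      refine sum_congr rfl fun C hC => ?_
      obtain ⟨C', -, rfl⟩ := mem_image.1 hC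
      rw [inter_erase, erase_eq_of_notMem (fun hm => not_mem_merge huq C' (mem_inter.1 hm).1)]
    have h2 := card_erase_add_one hqX
    rw [← h1]
    by_cases h3 : 2 ≤ #(X.erase q)
    · have := key _ h3 (notMem_erase _ _)
      omega
    · rw [spread_eq_zero_of_card_le_one _ (by omega)]
      omega
  · exact key X hX hqX

/-- If a tight set of the contracted system contains `u` and `D`, it comes from a set that is
nearly tight and meets `Q` in `u` and `q` only. -/
lemma IsSaturated.exists_of_isTight_merge {𝓒 : Finset (Finset V)} (h : IsSaturated 𝓒)
    {Q T D : Finset V} {u q : V} (hQ : Q ∈ 𝓒) (hu : u ∈ Q) (hq : q ∈ Q) (huq : u ≠ q)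
    (hD : ∀ T, IsTight 𝓒 T → u ∈ T → ¬ D ⊆ T) (hT : IsTight (𝓒.image (merge u q)) T)
    (huT : u ∈ T) (hDT : D ⊆ T) :
    ∃ Y, u ∈ Y ∧ q ∈ Y ∧ D ⊆ Y ∧ Q ∩ Y = {u, q} ∧ 2 * #Y ≤ spread 𝓒 Y + 4 := by
  have hqT : q ∉ T := by
    intro hqT
    have := hT.subset (h.isSparse_merge hQ hu hq huq)
      (N := (𝓒.image (merge u q)).biUnion id) (fun C hC => subset_biUnion_of_mem id hC) hqT
    obtain ⟨C, hC, hqC⟩ := mem_biUnion.1 this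
    obtain ⟨C', -, rfl⟩ := mem_image.1 hC
    exact not_mem_merge huq C' hqC
  have h0 := sum_card_merge_inter_le (𝓒 := 𝓒) T u q
  have h1 := sum_merge h hQ hu hq huq huT hqT
  have h2 : #(insert q T) = #T + 1 := card_insert_of_notMem hqT
  have h3 := hT.2
  have hT2 := hT.1
  have h4 : {u, q} ⊆ Q ∩ insert q T := by simp [insert_subset_iff, *]
  have h5 := card_le_card h4
  rw [card_pair huq] at h5
  -- With three vertices in `Q`, restoring `q` adds 2 to both sides of the count, so `insert q T`
  -- would be tight in `𝓒`. With only `u` and `q`, the spread grows by 1, which leaves a slack of at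
  -- most one.
  by_cases h6 : 3 ≤ #(Q ∩ insert q T)
  · exact absurd (hDT.trans (subset_insert _ _))
      (hD _ (IsTight.of_le h.sparse (X := insert q T) (by omega) (by omega)) (by simp [huT]))
  · refine ⟨insert q T, by simp [huT], by simp, hDT.trans (subset_insert _ _), ?_, by omega⟩
    exact (eq_of_subset_of_card_le h4 (by rw [card_pair huq]; omega)).symm

end Contraction

/-- In a body `Q` at `u` with at least three vertices, some vertex outside `D` can be merged
into `u` so that still no tight set contains both `u` and `D`. -/
lemma IsSaturated.exists_merge {𝓒 : Finset (Finset V)} (h : IsSaturated 𝓒) {Q D : Finset V}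
    {u : V} (hQ : Q ∈ 𝓒) (hu : u ∈ Q) (hQ3 : 3 ≤ #Q) (hDt : IsTight 𝓒 D)
    (hD : ∀ T, IsTight 𝓒 T → u ∈ T → ¬ D ⊆ T) :
    ∃ q ∈ Q, u ≠ q ∧ q ∉ D ∧
      ∀ T, IsTight (𝓒.image (merge u q)) T → u ∈ T → ¬ D ⊆ T := by
  by_contra! hcon
  have bad : ∀ q ∈ Q, u ≠ q → q ∉ D →
      ∃ Y, u ∈ Y ∧ q ∈ Y ∧ D ⊆ Y ∧ Q ∩ Y = {u, q} ∧ 2 * #Y ≤ spread 𝓒 Y + 4 := by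
    intro q hq huq hqD
    obtain ⟨T, hT, huT, hDT⟩ := hcon q hq huq hqD
    exact h.exists_of_isTight_merge hQ hu hq huq hD hT huT hDT
  have hQu : 2 ≤ #(Q.erase u) := by rw [card_erase_of_mem hu]; omega
  obtain ⟨q₁, q₂, hq₁, hq₂, hne⟩ := one_lt_card_iff.1 hQu
  rw [mem_erase] at hq₁ hq₂
  -- If `D` contained both `a` and `b`, the body around `D` would be `Q`, which contains `u`. If it
  -- contained `a` only, the set `Y` obtained from `b` would contain `a`, although it meets `Q` in
  -- `u` and `b` only.
  have hnotin : ∀ a b, a ∈ Q → b ∈ Q → a ≠ u → b ≠ u → a ≠ b → a ∉ D := by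
    intro a b ha hb hau hbu hab haD
    by_cases hbD : b ∈ D
    · obtain ⟨R, hR, hDR⟩ := h.exists_superset D hDt
      have : R = Q := h.eq_of_mem hR hQ hab (hDR haD) (hDR hbD) ha hb
      subst this
      exact hD R (isTight_of_subset_mem h.sparse hR (by omega) subset_rfl) hu hDR
    · obtain ⟨Y, -, -, hDY, hQY, -⟩ := bad b hb hbu.symm hbD
      have : a ∈ ({u, b} : Finset V) := hQY ▸ mem_inter.2 ⟨ha, hDY haD⟩
      simp [hau, hab] at this
  have hn₁ := hnotin q₁ q₂ hq₁.2 hq₂.2 hq₁.1 hq₂.1 hne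
  have hn₂ := hnotin q₂ q₁ hq₂.2 hq₁.2 hq₂.1 hq₁.1 hne.symm
  obtain ⟨Y₁, hu₁, hqY₁, hD₁, hQ₁, hc₁⟩ := bad q₁ hq₁.2 hq₁.1.symm hn₁
  obtain ⟨Y₂, hu₂, hqY₂, hD₂, hQ₂, hc₂⟩ := bad q₂ hq₂.2 hq₂.1.symm hn₂
  have hinter : Q ∩ (Y₁ ∩ Y₂) ⊆ {u} := by
    rw [inter_inter_distrib_left, hQ₁, hQ₂]
    intro x
    simp only [mem_inter, mem_insert, mem_singleton]
    rintro ⟨rfl | rfl, h3 | h3⟩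
    · rfl
    · rfl
    · exact h3
    · exact absurd h3 hne
  -- The strict gain at `Q` reduces the total slack of union and intersection to at most one. The
  -- union contains `u` and `D`, so it is not tight and uses up that slack; hence the intersection
  -- is tight, and it too contains `u` and `D`.
  have hlt := spread_add_spread_lt hQ (X := Y₁) (Y := Y₂)
    (by rw [hQ₁, card_pair hq₁.1.symm]) (by rw [hQ₂, card_pair hq₂.1.symm])
    (by simpa using card_le_card hinter)
  have hcard := card_union_add_card_inter Y₁ Y₂
  have h2i : 2 ≤ #(Y₁ ∩ Y₂) := hDt.1.trans (card_le_card (subset_inter hD₁ hD₂))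
  have h2u : 2 ≤ #(Y₁ ∪ Y₂) :=
    h2i.trans (card_le_card (inter_subset_left.trans subset_union_left))
  have hU : spread 𝓒 (Y₁ ∪ Y₂) + 3 ≠ 2 * #(Y₁ ∪ Y₂) := fun e =>
    hD _ ⟨h2u, e⟩ (mem_union_left _ hu₁) (hD₁.trans subset_union_left)
  have hU' := h.sparse _ h2u
  exact hD _ (IsTight.of_le h.sparse h2i (by omega)) (mem_inter.2 ⟨hu₁, hu₂⟩)
    (subset_inter hD₁ hD₂)

/-- A set of vertices `A` with a stable boundary contained in `S`: every body meets `S` in at most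
one vertex, and a body that meets `A` stays in `A ∪ S`. -/
structure IsStableSide (𝓒 : Finset (Finset V)) (A S : Finset V) : Prop where
  disjoint : Disjoint A S
  card_inter_le_one : ∀ C ∈ 𝓒, #(C ∩ S) ≤ 1
  subset_union : ∀ C ∈ 𝓒, ∀ x ∈ C, x ∈ A → C ⊆ A ∪ S

/-- Base case of the separation: when all bodies at `u` are pairs, the neighbours of `u` enclose it,
and a body with two of these neighbours would close a triangle. -/
lemma IsSaturated.isStableSide_singleton [Fintype V] {𝓒 : Finset (Finset V)} (h : IsSaturated 𝓒)
    {u : V} (hu : ∀ C ∈ 𝓒, u ∈ C → #C < 3) :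
    IsStableSide 𝓒 {u} (univ.filter fun x => x ≠ u ∧ {u, x} ∈ 𝓒) := by
  have hpair : ∀ C ∈ 𝓒, u ∈ C → ∀ x ∈ C, x ≠ u → C = {u, x} := by
    intro C hC huC x hxC hxu
    refine (eq_of_subset_of_card_le (by simp [insert_subset_iff, *]) ?_).symm
    rw [card_pair hxu.symm]
    have := hu C hC huC
    omega
  refine ⟨by simp, fun C hC => ?_, fun C hC x hxC hx y hyC => ?_⟩
  · rw [card_le_one]
    intro b hb c hc
    simp only [mem_inter, mem_filter, mem_univ, true_and] at hb hc
    by_contra hbc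
    by_cases huC : u ∈ C
    · have : c ∈ ({u, b} : Finset V) := hpair C hC huC b hb.1 hb.2.1 ▸ hc.1
      simp [hc.2.1, Ne.symm hbc] at this
    · refine huC ?_
      have hne : ({u, b} : Finset V) ≠ {u, c} := fun e => by
        have : b ∈ ({u, c} : Finset V) := e ▸ by simp
        simp [hb.2.1, hbc] at this
      have := h.no_triangle hb.2.2 hc.2.2 hC (x := u) (y := b) (z := c) hb.2.1.symm hbc
        (by simp) (by simp) (by simp) hb.1 (by simp) hc.1 hne
      rw [← this]
      simp
  · rw [mem_singleton] at hx
    subst hx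
    by_cases hy : y = x
    · simp [hy]
    · simp [hy, ← hpair C hC hxC y hyC hy, hC]

/-- To undo the merge, `q` joins `u` inside `A`: a body through `q` has an image through `u`, which
stays in `A ∪ S`. -/
lemma IsStableSide.of_merge {𝓒 : Finset (Finset V)} {u q : V} {A S : Finset V}
    (hA : IsStableSide (𝓒.image (merge u q)) A S) (hu : u ∈ A) :
    IsStableSide 𝓒 (insert q A) (S.erase q) where
  disjoint := by
    rw [disjoint_insert_left]
    exact ⟨notMem_erase _ _, hA.disjoint.mono_right (erase_subset _ _)⟩
  card_inter_le_one C hC := by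
    refine le_trans (card_le_card ?_) (hA.card_inter_le_one _ (mem_image_of_mem _ hC))
    intro x hx
    rw [mem_inter, mem_erase] at hx
    exact mem_inter.2 ⟨merge_subset C (mem_erase.2 ⟨hx.2.1, hx.1⟩), hx.2.2⟩
  subset_union C hC x hxC hx := by
    have key : merge u q C ⊆ A ∪ S := by
      by_cases hq : q ∈ C
      · exact hA.subset_union _ (mem_image_of_mem _ hC) u (by simp [merge, hq]) hu
      · refine hA.subset_union _ (mem_image_of_mem _ hC) x (by simp [merge, hq, hxC]) ?_
        exact mem_of_mem_insert_of_ne hx (fun e => hq (e ▸ hxC))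
    intro y hy
    by_cases hyq : y = q
    · simp [hyq]
    · have := key (merge_subset C (mem_erase.2 ⟨hyq, hy⟩))
      simp only [mem_union, mem_insert, mem_erase] at this ⊢
      tauto

/-- In a sparse system a vertex can be separated from a tight set by a stable set, unless both
lie in one tight set. -/
theorem exists_isStableSide [Fintype V] (n : ℕ) :
    ∀ {𝓒 : Finset (Finset V)}, IsSparse 𝓒 → ∀ {N : Finset V}, #N ≤ n → (∀ C ∈ 𝓒, C ⊆ N) →
      ∀ {u : V} {D : Finset V}, IsTight 𝓒 D → (∀ T, IsTight 𝓒 T → u ∈ T → ¬ D ⊆ T) →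
      ∃ A S, IsStableSide 𝓒 A S ∧ u ∈ A ∧ Disjoint D A := by
  induction n with
  | zero =>
    intro 𝓒 hs N hN hCN u D hDt hD
    have h1 := card_le_card (hDt.subset hs hCN)
    have h2 := hDt.1
    omega
  | succ n ih =>
    intro 𝓒 hs N hN hCN u D hDt hD
    have hsat := isSaturated_components hs
    have huD : u ∉ D := fun hu => hD D hDt hu subset_rfl
    have hDt' : IsTight (components 𝓒) D := by
      obtain ⟨R, hR, hDR⟩ := exists_mem_components hDt
      exact isTight_of_subset_mem hsat.sparse hR hDt.1 hDR
    have hD' : ∀ T, IsTight (components 𝓒) T → u ∈ T → ¬ D ⊆ T := by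
      intro T hT huT hDT
      obtain ⟨R, hR, hTR⟩ := hsat.exists_superset T hT
      exact hD R (mem_components.1 hR).1 (hTR huT) (hDT.trans hTR)
    have hCN' : ∀ C ∈ components 𝓒, C ⊆ N := fun C hC =>
      (mem_components.1 hC).1.subset hs hCN
    -- Every body of size at least two lies in a component, so a side that is stable for the
    -- components is stable for `𝓒`.
    suffices H : ∃ A S, IsStableSide (components 𝓒) A S ∧ u ∈ A ∧ Disjoint D A by
      obtain ⟨A, S, hAS, huA, hDA⟩ := H
      have hsub : ∀ C ∈ 𝓒, 2 ≤ #C → ∃ R ∈ components 𝓒, C ⊆ R := fun C hC h2 =>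
        exists_mem_components (isTight_of_subset_mem hs hC h2 subset_rfl)
      refine ⟨A, S, ⟨hAS.disjoint, fun C hC => ?_, fun C hC x hxC hx => ?_⟩, huA, hDA⟩
      · by_cases h2 : 2 ≤ #C
        · obtain ⟨R, hR, hCR⟩ := hsub C hC h2
          exact (card_le_card (inter_subset_inter_right hCR)).trans (hAS.card_inter_le_one R hR)
        · exact (card_le_card inter_subset_left).trans (by omega)
      · by_cases h2 : 2 ≤ #C
        · obtain ⟨R, hR, hCR⟩ := hsub C hC h2
          exact hCR.trans (hAS.subset_union R hR x (hCR hxC) hx)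
        · intro y hy
          rw [card_le_one.1 (by omega : #C ≤ 1) y hy x hxC]
          exact mem_union_left _ hx
    -- A body at `u` of size at least three allows a merge, which removes `q` from the ground set
    -- `N` and feeds the induction.
    by_cases hbig : ∃ Q ∈ components 𝓒, u ∈ Q ∧ 3 ≤ #Q
    · obtain ⟨Q, hQ, huQ, hQ3⟩ := hbig
      obtain ⟨q, hqQ, huq, hqD, hT⟩ := hsat.exists_merge hQ huQ hQ3 hDt' hD'
      have hmD : IsTight ((components 𝓒).image (merge u q)) D := by
        obtain ⟨R, hR, hDR⟩ := exists_mem_components hDt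
        refine isTight_of_subset_mem (hsat.isSparse_merge hQ huQ hqQ huq)
          (mem_image_of_mem _ hR) hDt.1 fun x hx => ?_
        exact merge_subset R (mem_erase.2 ⟨fun e => hqD (e ▸ hx), hDR hx⟩)
      have hqN := hCN' Q hQ hqQ
      obtain ⟨A, S, hAS, huA, hDA⟩ := ih (hsat.isSparse_merge hQ huQ hqQ huq)
        (N := N.erase q) (by rw [card_erase_of_mem hqN]; omega)
        (by
          intro C hC x hx
          have hxq : x ≠ q := by
            rintro rfl
            obtain ⟨C', -, rfl⟩ := mem_image.1 hC
            exact not_mem_merge huq C' hx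
          refine mem_erase.2 ⟨hxq, ?_⟩
          obtain ⟨C', hC', rfl⟩ := mem_image.1 hC
          unfold merge at hx
          split_ifs at hx
          · rcases mem_insert.1 hx with rfl | hx
            · exact hCN' Q hQ huQ
            · exact hCN' C' hC' (mem_of_mem_erase hx)
          · exact hCN' C' hC' hx) hmD hT
      refine ⟨insert q A, S.erase q, hAS.of_merge huA, mem_insert_of_mem huA, ?_⟩
      rw [disjoint_insert_right]
      exact ⟨hqD, hDA⟩
    · push Not at hbig
      exact ⟨{u}, _, hsat.isStableSide_singleton hbig, mem_singleton_self u, by simpa using huD⟩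

end SparseSystems

/-! ### Self-stresses and generic realisations. -/

section Stresses

open Finset Matrix

variable {W : Type*}

/-- The coordinates of a realisation. -/
def coords (p : W → Plane) (a : W × Fin 2) : ℝ := p a.1 a.2

/-- A polynomial with rational coefficients which does not vanish at some point does not vanish at
a generic realisation. -/
lemma IsGeneric.aeval_ne_zero {p : W → Plane} (hp : IsGeneric p) {P : MvPolynomial (W × Fin 2) ℚ}
    {x : W × Fin 2 → ℝ} (hx : MvPolynomial.aeval x P ≠ 0) :
    MvPolynomial.aeval (coords p) P ≠ 0 := by
  intro h
  have : P = 0 := (algebraicIndependent_iff.1 hp) P h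
  exact hx (by simp [this])

/-- No three points of a generic realisation are collinear. -/
lemma IsGeneric.det_ne_zero {p : W → Plane} (hp : IsGeneric p) {a b c : W} (hab : a ≠ b)
    (hac : a ≠ c) (hbc : b ≠ c) :
    (p b 0 - p a 0) * (p c 1 - p a 1) - (p b 1 - p a 1) * (p c 0 - p a 0) ≠ 0 := by
  classical
  let P : MvPolynomial (W × Fin 2) ℚ :=
    (.X (b, 0) - .X (a, 0)) * (.X (c, 1) - .X (a, 1)) -
      (.X (b, 1) - .X (a, 1)) * (.X (c, 0) - .X (a, 0))
  -- The test point has `a` at the origin, `b` at `(1, 0)` and `c` at `(0, 1)`.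
  have h := hp.aeval_ne_zero (P := P)
    (x := fun y => if y = (b, 0) ∨ y = (c, 1) then 1 else 0) (by
      simp [P, hab, hac, hbc, hbc.symm])
  simpa [P, coords] using h

lemma IsGeneric.injective {p : W → Plane} (hp : IsGeneric p) : Function.Injective p := by
  intro a b hab
  have := AlgebraicIndependent.injective hp
  have h2 := @this (a, 0) (b, 0) (by simp [hab])
  exact congrArg Prod.fst h2

variable [Fintype W] [DecidableEq W]

/-- The framework with edge set `E` (given by two-element sets) and realisation `p` has no nonzero
self-stress. -/
def Independent (E : Finset (Finset W)) (p : W → Plane) : Prop :=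
  ∀ l : Finset W → ℝ, (∀ e, e ∉ E → l e = 0) →
    (∀ w, ∑ x, l {w, x} • (p w - p x) = 0) → l = 0

/-- The rigidity matrix of the framework with edge set `E` and coordinates `x`. -/
def rigidityMatrix {R : Type*} [CommRing R] (E : Finset (Finset W)) (x : W × Fin 2 → R) :
    Matrix E (W × Fin 2) R :=
  fun e a => ∑ v, if (e : Finset W) = {a.1, v} then x a - x (v, a.2) else 0

lemma vecMul_rigidityMatrix (E : Finset (Finset W)) (p : W → Plane) (l : Finset W → ℝ)
    (hl : ∀ e, e ∉ E → l e = 0) (w : W) (i : Fin 2) :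
    ((fun e : E => l e) ᵥ* rigidityMatrix E (coords p)) (w, i) =
      (∑ x, l {w, x} • (p w - p x)) i := by
  have h1 : (∑ x, l {w, x} • (p w - p x)) i = ∑ x, l {w, x} * (p w i - p x i) := by
    simp [WithLp.ofLp_sum]
  rw [h1, vecMul, dotProduct]
  simp only [rigidityMatrix, coords, mul_sum]
  rw [sum_comm]
  refine sum_congr rfl fun x _ => ?_
  by_cases hx : ({w, x} : Finset W) ∈ E
  · rw [sum_eq_single (⟨{w, x}, hx⟩ : E)]
    · simp
    · intro e _ he
      rw [if_neg (fun h => he (Subtype.ext h)), mul_zero]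
    · simp
  · rw [hl _ hx, zero_mul]
    refine sum_eq_zero fun e _ => ?_
    rw [if_neg (fun h : (e : Finset W) = {w, x} => hx (h ▸ e.2)), mul_zero]

lemma independent_iff_vecMul {E : Finset (Finset W)} {p : W → Plane} :
    Independent E p ↔ ∀ l : E → ℝ, l ᵥ* rigidityMatrix E (coords p) = 0 → l = 0 := by
  constructor
  · intro h l hl
    let l' : Finset W → ℝ := fun e => if he : e ∈ E then l ⟨e, he⟩ else 0
    have h1 : ∀ e, e ∉ E → l' e = 0 := fun e he => dif_neg he
    have h2 : (fun e : E => l' e) = l := by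
      funext e
      simp [l']
    have h3 : l' = 0 := h l' h1 fun w => by
      ext i
      rw [← vecMul_rigidityMatrix E p l' h1, h2, hl]
      rfl
    rw [← h2, h3]
    rfl
  · intro h l hl hs
    have h1 := h (fun e : E => l e) <| by
      ext ⟨w, i⟩
      rw [vecMul_rigidityMatrix E p l hl, hs w]
      rfl
    funext e
    by_cases he : e ∈ E
    · exact congrFun h1 ⟨e, he⟩
    · exact hl e he

/-- The Gram determinant of the rows is a polynomial in the coordinates. This gives both openness of
independence and its transfer to generic points. -/
lemma independent_iff_det {E : Finset (Finset W)} {p : W → Plane} :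
    Independent E p ↔
      (rigidityMatrix E (coords p) * (rigidityMatrix E (coords p))ᵀ).det ≠ 0 := by
  rw [independent_iff_vecMul, ne_eq, ← exists_vecMul_eq_zero_iff]
  push Not
  constructor
  · intro h l hl hz
    refine hl (h l ?_)
    rwa [← conjTranspose_eq_transpose_of_trivial, vecMul_self_mul_conjTranspose_eq_zero] at hz
  · intro h l hz
    by_contra hne
    refine h l hne ?_
    rw [← vecMul_vecMul, hz, zero_vecMul]

lemma isOpen_independent (E : Finset (Finset W)) : IsOpen {p : W → Plane | Independent E p} := by
  simp only [independent_iff_det]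
  refine isOpen_ne_fun ?_ continuous_const
  have : Continuous fun p : W → Plane => rigidityMatrix E (coords p) := by
    refine continuous_matrix fun e a => ?_
    unfold rigidityMatrix coords
    refine continuous_finsetSum _ fun v _ => ?_
    split_ifs
    · fun_prop
    · exact continuous_const
  fun_prop

lemma rigidityMatrix_map {R S : Type*} [CommRing R] [CommRing S] (f : R →+* S)
    (E : Finset (Finset W)) (x : W × Fin 2 → R) :
    (rigidityMatrix E x).map f = rigidityMatrix E (fun a => f (x a)) := by
  ext e a
  simp only [rigidityMatrix, map_apply, map_sum]
  refine sum_congr rfl fun v _ => ?_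
  split_ifs <;> simp

/-- The Gram determinant has rational coefficients; if it is nonzero at one realisation, it is
nonzero at every generic one. Special positions thus suffice in the Henneberg induction. -/
lemma IsGeneric.independent {p q : W → Plane} (hp : IsGeneric p) {E : Finset (Finset W)}
    (hq : Independent E q) : Independent E p := by
  let A : Matrix E (W × Fin 2) (MvPolynomial (W × Fin 2) ℚ) := rigidityMatrix E MvPolynomial.X
  let P : MvPolynomial (W × Fin 2) ℚ := (A * Aᵀ).det
  have hP : ∀ r : W → Plane, MvPolynomial.aeval (coords r) P =
      (rigidityMatrix E (coords r) * (rigidityMatrix E (coords r))ᵀ).det := by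
    intro r
    have h1 := rigidityMatrix_map (MvPolynomial.aeval (R := ℚ) (coords r)).toRingHom E
      (MvPolynomial.X : W × Fin 2 → MvPolynomial (W × Fin 2) ℚ)
    simp only [AlgHom.toRingHom_eq_coe, RingHom.coe_coe, MvPolynomial.aeval_X] at h1
    simp only [P, A]
    rw [AlgHom.map_det, AlgHom.mapMatrix_apply, Matrix.map_mul,
      transpose_map, h1]
  rw [independent_iff_det, ← hP] at hq ⊢
  exact hp.aeval_ne_zero hq

end Stresses

/-! ### Henneberg moves: sparse edge sets are generically independent. -/

section Henneberg

open Finset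

variable {W : Type*} [DecidableEq W]

lemma exists_pair_of_mem {E : Finset (Finset W)} (hE : ∀ e ∈ E, #e = 2) {e : Finset W}
    (he : e ∈ E) {v : W} (hv : v ∈ e) : ∃ x, v ≠ x ∧ e = {v, x} := by
  obtain ⟨x, y, hxy, rfl⟩ := card_eq_two.1 (hE e he)
  rw [mem_insert, mem_singleton] at hv
  rcases hv with rfl | rfl
  · exact ⟨y, hxy, rfl⟩
  · exact ⟨x, hxy.symm, pair_comm _ _⟩

/-- Two vertices can be joined by a new edge unless a tight set contains them. -/
lemma IsSparse.insert_pair_or {E : Finset (Finset W)} (hs : IsSparse E) {a b : W} (hab : a ≠ b) :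
    ({a, b} ∉ E ∧ IsSparse (insert {a, b} E)) ∨ ∃ T, IsTight E T ∧ a ∈ T ∧ b ∈ T := by
  by_cases h : {a, b} ∈ E
  · exact Or.inr ⟨{a, b}, isTight_of_subset_mem hs h (card_pair hab).ge subset_rfl, by simp, by simp⟩
  · by_cases h2 : IsSparse (insert {a, b} E)
    · exact Or.inl ⟨h, h2⟩
    · right
      unfold IsSparse at h2
      push Not at h2
      obtain ⟨X, hX, hlt⟩ := h2
      rw [spread, sum_insert h, ← spread] at hlt
      have h3 := hs X hX
      have h4 := card_le_card (inter_subset_left (s₁ := {a, b}) (s₂ := X))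
      rw [card_pair hab] at h4
      have h5 : {a, b} ∩ X = {a, b} :=
        eq_of_subset_of_card_le inter_subset_left (by rw [card_pair hab]; omega)
      have h6 : {a, b} ⊆ X := inter_eq_left.1 h5
      exact ⟨X, .of_le hs hX (by omega), h6 (by simp), h6 (by simp)⟩

variable [Fintype W]

lemma eq_zero_of_smul_add_smul_eq_zero {x y : Plane} (h : x 0 * y 1 - x 1 * y 0 ≠ 0) {s t : ℝ}
    (hst : s • x + t • y = 0) : s = 0 ∧ t = 0 := by
  have h0 : s * x 0 + t * y 0 = 0 := by simpa using congrFun (congrArg WithLp.ofLp hst) 0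
  have h1 : s * x 1 + t * y 1 = 0 := by simpa using congrFun (congrArg WithLp.ofLp hst) 1
  constructor
  · refine (mul_eq_zero.1 (?_ : s * (x 0 * y 1 - x 1 * y 0) = 0)).resolve_right h
    linear_combination y 1 * h0 - y 0 * h1
  · refine (mul_eq_zero.1 (?_ : t * (x 0 * y 1 - x 1 * y 0) = 0)).resolve_right h
    linear_combination x 0 * h1 - x 1 * h0

/-- Only the edges at a vertex contribute to its equilibrium condition. -/
lemma sum_stress_eq {E : Finset (Finset W)} {l : Finset W → ℝ} (hl : ∀ e, e ∉ E → l e = 0)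
    (p : W → Plane) {v : W} {M : Finset W} (hM : ∀ x, {v, x} ∈ E → x ∈ M) :
    ∑ x, l {v, x} • (p v - p x) = ∑ x ∈ M, l {v, x} • (p v - p x) := by
  refine (sum_subset (subset_univ M) fun x _ hx => ?_).symm
  rw [hl _ (fun h => hx (hM x h)), zero_smul]

/-- Adding a vertex whose edges have linearly independent directions preserves independence. -/
lemma Independent.of_vertex {E : Finset (Finset W)} {p : W → Plane} {v : W} {M : Finset W}
    (hE : ∀ e ∈ E, #e = 2) (hp : Independent (E.filter (v ∉ ·)) p)
    (hM : ∀ x, {v, x} ∈ E → x ∈ M)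
    (hlin : ∀ s : W → ℝ, ∑ x ∈ M, s x • (p v - p x) = 0 → ∀ x ∈ M, s x = 0) :
    Independent E p := by
  intro l hl hs
  have h1 := hs v
  rw [sum_stress_eq hl p hM] at h1
  have h2 := hlin _ h1
  refine hp l (fun e he => ?_) hs
  by_cases heE : e ∈ E
  · rw [mem_filter, not_and, not_not] at he
    obtain ⟨x, -, rfl⟩ := exists_pair_of_mem hE heE (he heE)
    exact h2 x (hM x heE)
  · exact hl e heE

/-- The one-extension: a vertex of degree three is placed on the midpoint of the edge `ab` which it
replaces. -/
lemma Independent.one_extension {E : Finset (Finset W)} {p : W → Plane} {v a b c : W}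
    (hE : ∀ e ∈ E, #e = 2)
    (hva : v ≠ a) (hvb : v ≠ b) (hab : a ≠ b) (hac : a ≠ c) (hbc : b ≠ c)
    (hnot : {a, b} ∉ E)
    (hp : Independent (insert {a, b} (E.filter (v ∉ ·))) p)
    (hM : ∀ x, {v, x} ∈ E → x = a ∨ x = b ∨ x = c)
    (hdet : (p a - p b) 0 * (p c - p a) 1 - (p a - p b) 1 * (p c - p a) 0 ≠ 0) (hvc : v ≠ c) :
    Independent E (Function.update p v ((1 / 2 : ℝ) • (p a + p b))) := by
  intro l hl hs
  set q := Function.update p v ((1 / 2 : ℝ) • (p a + p b)) with hq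
  have hqv : q v = (1 / 2 : ℝ) • (p a + p b) := by simp [hq]
  have hqx : ∀ x, x ≠ v → q x = p x := fun x hx => by simp [hq, hx]
  have h1 := hs v
  rw [sum_stress_eq hl q (M := {a, b, c}) (by simpa using hM),
    sum_insert (by simp [hab, hac]), sum_pair hbc, hqv, hqx a hva.symm, hqx b hvb.symm,
    hqx c hvc.symm] at h1
  -- Equilibrium at the midpoint, rewritten in the independent directions `p a - p b` and `p c - p
  -- a`: the stress on `vc` vanishes and those on `va` and `vb` agree.
  have h2 : ((l {v, b} - l {v, a}) / 2 + (- l {v, c}) / 2) • (p a - p b) +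
      (- l {v, c}) • (p c - p a) = 0 := by
    rw [← h1]
    module
  obtain ⟨h3, h4⟩ := eq_zero_of_smul_add_smul_eq_zero hdet h2
  have hc0 : l {v, c} = 0 := by linarith
  have hab' : l {v, b} = l {v, a} := by linarith
  -- Two bars of half the length with equal stress act on `a` and `b` as the single bar `ab` with
  -- half that stress.
  let l' : Finset W → ℝ := fun e => if e = {a, b} then l {v, a} / 2 else if v ∈ e then 0 else l e
  have hl' : ∀ e, e ∉ insert {a, b} (E.filter (v ∉ ·)) → l' e = 0 := by
    intro e he
    simp only [mem_insert, mem_filter, not_or, not_and, not_not] at he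
    simp only [l', if_neg he.1]
    split_ifs with hv
    · rfl
    · exact hl e fun h => hv (he.2 h)
  have hl0 : l {a, b} = 0 := hl _ hnot
  have hvx : ∀ x, x ≠ a → x ≠ b → l {v, x} = 0 := by
    intro x hxa hxb
    by_cases hx : {v, x} ∈ E
    · rcases hM x hx with rfl | rfl | rfl
      · exact absurd rfl hxa
      · exact absurd rfl hxb
      · exact hc0
    · exact hl _ hx
  have key : l' = 0 := by
    refine hp l' hl' fun w => ?_
    by_cases hwv : w = v
    · refine sum_eq_zero fun x _ => ?_
      have : ({w, x} : Finset W) ≠ {a, b} := fun h => by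
        have : w ∈ ({a, b} : Finset W) := h ▸ by simp
        rw [hwv] at this
        simp [hva, hvb] at this
      simp only [l', if_neg this]
      simp [hwv]
    · rw [← hs w, ← sub_eq_zero, ← sum_sub_distrib]
      have hterm : ∀ x, x ≠ v → ({w, x} : Finset W) ≠ {a, b} →
          l' {w, x} • (p w - p x) - l {w, x} • (q w - q x) = 0 := by
        intro x hxv hne
        simp [l', hne, hqx x hxv, hqx w hwv, Ne.symm hxv, Ne.symm hwv]
      have hv0 : l' {w, v} = 0 := by
        have : ({w, v} : Finset W) ≠ {a, b} := fun h => by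
          have : v ∈ ({a, b} : Finset W) := h ▸ by simp
          simp [hva, hvb] at this
        simp [l', this]
      have two : ∀ y : W, y ≠ v → ({w, y} : Finset W) = {a, b} → l {w, v} = l {v, a} →
          (∀ x, ({w, x} : Finset W) = {a, b} → x = y) →
          (p w + p y = p a + p b) →
          ∑ x, (l' {w, x} • (p w - p x) - l {w, x} • (q w - q x)) = 0 := by
        intro y hyv hwy hlw huniq hsum
        rw [sum_eq_add (a := y) (b := v) hyv (fun x _ hx => hterm x hx.2 fun h => hx.1 (huniq x h))
          (by simp) (by simp), hv0, hwy, hl0, hlw, hqv, hqx w hwv, ← hsum]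
        simp only [l', if_true]
        module
      by_cases hwa : w = a
      · refine two b hvb.symm (by rw [hwa]) (by rw [hwa, pair_comm]) (fun x hx => ?_) (by rw [hwa])
        have : b ∈ ({w, x} : Finset W) := hx ▸ by simp
        simp only [mem_insert, mem_singleton, hwa, hab.symm, false_or] at this
        exact this.symm
      · by_cases hwb : w = b
        · refine two a hva.symm (by rw [hwb, pair_comm]) (by rw [hwb, pair_comm, hab'])
            (fun x hx => ?_) (by rw [hwb, add_comm])
          have : a ∈ ({w, x} : Finset W) := hx ▸ by simp
          simp only [mem_insert, mem_singleton, hwb, hab, false_or] at this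
          exact this.symm
        · refine sum_eq_zero fun x _ => ?_
          by_cases hxv : x = v
          · rw [hxv, hv0, pair_comm, hvx w hwa hwb]
            simp
          · refine hterm x hxv fun h => ?_
            have : w ∈ ({a, b} : Finset W) := h ▸ by simp
            simp [hwa, hwb] at this
  have hva0 : l {v, a} = 0 := by
    have := congrFun key {a, b}
    simp only [l', if_true, Pi.zero_apply] at this
    linarith
  funext e
  by_cases heE : e ∈ E
  · by_cases hv : v ∈ e
    · obtain ⟨y, -, hy⟩ := exists_pair_of_mem hE heE hv
      subst hy
      by_cases hya : y = a
      · rw [hya]; exact hva0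
      · by_cases hyb : y = b
        · rw [hyb, hab']; exact hva0
        · exact hvx y hya hyb
    · have := congrFun key e
      have hne : e ≠ {a, b} := fun h => hnot (h ▸ heE)
      simpa [l', hne, hv] using this
  · exact hl e heE

/-- At a vertex of degree three two of the neighbours can be joined after deleting the vertex. -/
lemma IsSparse.exists_reduction {E : Finset (Finset W)} (hs : IsSparse E)
    {v a b c : W} (hva : v ≠ a) (hvb : v ≠ b) (hvc : v ≠ c) (hab : a ≠ b) (hac : a ≠ c)
    (hbc : b ≠ c) (ha : {v, a} ∈ E) (hb : {v, b} ∈ E) (hc : {v, c} ∈ E) :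
    ({a, b} ∉ E.filter (v ∉ ·) ∧ IsSparse (insert {a, b} (E.filter (v ∉ ·)))) ∨
    ({a, c} ∉ E.filter (v ∉ ·) ∧ IsSparse (insert {a, c} (E.filter (v ∉ ·)))) ∨
    ({b, c} ∉ E.filter (v ∉ ·) ∧ IsSparse (insert {b, c} (E.filter (v ∉ ·)))) := by
  set F := E.filter (v ∉ ·) with hF
  have hsF : IsSparse F := hs.mono (filter_subset _ _)
  have hsat := isSaturated_components hsF
  by_contra hcon
  push Not at hcon
  obtain ⟨T₁, hT₁, ha₁, hb₁⟩ := (hsF.insert_pair_or hab).resolve_left fun h => hcon.1 h.1 h.2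
  obtain ⟨T₂, hT₂, ha₂, hc₂⟩ := (hsF.insert_pair_or hac).resolve_left fun h => hcon.2.1 h.1 h.2
  obtain ⟨T₃, hT₃, hb₃, hc₃⟩ := (hsF.insert_pair_or hbc).resolve_left fun h => hcon.2.2 h.1 h.2
  obtain ⟨R₁, hR₁, h₁⟩ := exists_mem_components hT₁
  obtain ⟨R₂, hR₂, h₂⟩ := exists_mem_components hT₂
  obtain ⟨R₃, hR₃, h₃⟩ := exists_mem_components hT₃
  -- The absence of triangles forces the three components to share one that contains `a`, `b` and
  -- `c`. Adding `v` to it brings three edges but raises the bound by only 2, against sparsity of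
  -- `E`.
  obtain ⟨haR, hbR, hcR⟩ : a ∈ R₁ ∧ b ∈ R₁ ∧ c ∈ R₁ := by
    refine ⟨h₁ ha₁, h₁ hb₁, ?_⟩
    by_cases he : R₁ = R₂
    · exact he ▸ h₂ hc₂
    · rw [hsat.no_triangle hR₁ hR₂ hR₃ hab hbc (h₁ ha₁) (h₂ ha₂) (h₁ hb₁) (h₃ hb₃) (h₂ hc₂)
        (h₃ hc₃) he]
      exact h₃ hc₃
  have hR := (mem_components.1 hR₁).1
  have hvR : v ∉ R₁ := fun hv => by
    have := hR.subset hsF (N := univ.erase v)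
      (fun C hC x hx => by
        rw [hF, mem_filter] at hC
        exact mem_erase.2 ⟨fun e => hC.2 (e ▸ hx), mem_univ x⟩) hv
    simp at this
  have hne : ∀ x y : W, v ≠ x → x ≠ y → ({v, x} : Finset W) ≠ {v, y} := by
    intro x y hvx hxy h
    have : x ∈ ({v, y} : Finset W) := h ▸ by simp
    simp [hvx.symm, hxy] at this
  have hdisj : Disjoint F {{v, a}, {v, b}, {v, c}} := by
    simp [hF]
  have h1 := spread_mono_left (𝓒 := F ∪ {{v, a}, {v, b}, {v, c}}) (𝓓 := E)
    (union_subset (filter_subset _ _) (by simp [insert_subset_iff, *])) (insert v R₁)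
  have hint : ∀ x, v ≠ x → x ∈ R₁ → 2 * #({v, x} ∩ insert v R₁) - 3 = 1 := by
    intro x hvx hx
    rw [inter_eq_left.2 (by simp [insert_subset_iff, hx]), card_pair hvx]
  rw [spread, sum_union hdisj, ← spread, sum_insert (by simp [hne a b hva hab, hne a c hva hac]),
    sum_pair (hne b c hvb hbc), hint a hva haR, hint b hvb hbR, hint c hvc hcR] at h1
  have h2 := spread_mono_right F (subset_insert v R₁)
  have h3 : #(insert v R₁) = #R₁ + 1 := card_insert_of_notMem hvR
  have h4 := hs (insert v R₁) (by have := hR.1; omega)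
  have h5 := hR.2
  omega

/-- A nonempty sparse edge set has a vertex of degree one, two or three. -/
lemma IsSparse.exists_degree_le {E : Finset (Finset W)} (hs : IsSparse E) (hE : ∀ e ∈ E, #e = 2)
    (hne : E.Nonempty) : ∃ v, (∃ e ∈ E, v ∈ e) ∧ #(univ.filter fun x => {v, x} ∈ E) ≤ 3 := by
  set U := E.biUnion id with hU
  have hsub : ∀ e ∈ E, e ⊆ U := fun e he => subset_biUnion_of_mem id he
  have hsum : ∑ v ∈ U, #(E.filter (v ∈ ·)) = 2 * #E := by
    simp_rw [card_filter]
    rw [sum_comm, mul_comm, ← smul_eq_mul, ← sum_const]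
    refine sum_congr rfl fun e he => ?_
    rw [← card_filter, filter_mem_eq_inter, inter_eq_right.2 (hsub e he), hE e he]
  have hspread : spread E U = #E := by
    rw [spread, card_eq_sum_ones]
    refine sum_congr rfl fun e he => ?_
    rw [inter_eq_left.2 (hsub e he), hE e he]
  have hU2 : 2 ≤ #U := by
    obtain ⟨e, he⟩ := hne
    exact (hE e he).ge.trans (card_le_card (hsub e he))
  have h1 := hs U hU2
  -- By sparsity the degree sum `2 * #E` is less than `4 * #U`.
  obtain ⟨v, hv, hlt⟩ := exists_lt_of_sum_lt (s := U) (f := fun v => #(E.filter (v ∈ ·)))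
    (g := fun _ => 4) (by rw [hsum, sum_const, smul_eq_mul]; omega)
  refine ⟨v, by simpa [hU] using hv, ?_⟩
  refine le_trans (card_le_card_of_injOn (t := E.filter (v ∈ ·)) (fun x => {v, x}) ?_ ?_)
    (Nat.lt_succ_iff.1 hlt)
  · intro x hx
    simpa using hx
  · intro x hx y hy hxy
    have hxE : ({v, x} : Finset W) ∈ E := by simpa using hx
    have hvx : v ≠ x := by
      rintro rfl
      have := hE _ hxE
      simp at this
    have : x ∈ ({v, y} : Finset W) := (show ({v, x} : Finset W) = {v, y} from hxy) ▸ by simp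
    simpa [hvx.symm] using this

/-- Sparse edge sets are independent at generic realisations. -/
theorem IsSparse.independent_of_card_le {p : W → Plane} (hp : IsGeneric p) (n : ℕ) :
    ∀ {E : Finset (Finset W)}, IsSparse E → (∀ e ∈ E, #e = 2) → ∀ {N : Finset W}, #N ≤ n →
      (∀ e ∈ E, e ⊆ N) → Independent E p := by
  induction n with
  | zero =>
    intro E hs hE N hN hEN l hl _
    funext e
    refine hl e fun he => ?_
    have := card_le_card (hEN e he)
    have := hE e he
    omega
  | succ n ih =>
    intro E hs hE N hN hEN
    by_cases hne : E.Nonempty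
    swap
    · intro l hl _
      funext e
      exact hl e fun he => hne ⟨e, he⟩
    obtain ⟨v, ⟨e₀, he₀, hve₀⟩, hdeg⟩ := hs.exists_degree_le hE hne
    set M := univ.filter fun x => {v, x} ∈ E with hMdef
    have hmem : ∀ x, x ∈ M ↔ {v, x} ∈ E := fun x => by simp [hMdef]
    have hvM : ∀ x ∈ M, v ≠ x := by
      rintro x hx rfl
      have := hE _ ((hmem _).1 hx)
      simp at this
    have hvN : v ∈ N := hEN e₀ he₀ hve₀
    have hN' : #(N.erase v) ≤ n := by rw [card_erase_of_mem hvN]; omega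
    have hFN : ∀ e ∈ E.filter (v ∉ ·), e ⊆ N.erase v := by
      intro e he x hx
      rw [mem_filter] at he
      exact mem_erase.2 ⟨fun h => he.2 (h ▸ hx), hEN e he.1 hx⟩
    have hF : Independent (E.filter (v ∉ ·)) p :=
      ih (hs.mono (filter_subset _ _)) (fun e he => hE e (mem_filter.1 he).1) hN' hFN
    have ext1 : ∀ a b c, M = {a, b, c} → a ≠ b → a ≠ c → b ≠ c →
        {a, b} ∉ E.filter (v ∉ ·) → IsSparse (insert {a, b} (E.filter (v ∉ ·))) →
        Independent E p := by
      intro a b c hM hab hac hbc hnot hsp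
      have haM : a ∈ M := by simp [hM]
      have hbM : b ∈ M := by simp [hM]
      have hcM : c ∈ M := by simp [hM]
      have hNab : {a, b} ⊆ N.erase v := by
        simp only [insert_subset_iff, singleton_subset_iff, mem_erase]
        exact ⟨⟨(hvM a haM).symm, hEN _ ((hmem a).1 haM) (by simp)⟩,
          (hvM b hbM).symm, hEN _ ((hmem b).1 hbM) (by simp)⟩
      have hI := ih hsp (fun e he => by
        rcases mem_insert.1 he with rfl | he
        · exact card_pair hab
        · exact hE e (mem_filter.1 he).1) hN' (fun e he => by
        rcases mem_insert.1 he with rfl | he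
        · exact hNab
        · exact hFN e he)
      -- The one-extension is independent with `v` on the line `ab`, a non-generic position;
      -- independence then passes to `p`.
      refine hp.independent (hI.one_extension hE (hvM a haM) (hvM b hbM) hab hac hbc ?_ ?_ ?_
        (hvM c hcM))
      · intro h
        exact hnot (mem_filter.2 ⟨h, by simp [hvM a haM, hvM b hbM]⟩)
      · intro x hx
        simpa [hM] using (hmem x).2 hx
      · intro h
        refine hp.det_ne_zero hab hac hbc ?_
        simp only [PiLp.sub_apply] at h
        linear_combination -h
    have hM1 : ∀ x, {v, x} ∈ E → x ∈ M := fun x hx => (hmem x).2 hx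
    interval_cases hc : #M
    · obtain ⟨x, -, rfl⟩ := exists_pair_of_mem hE he₀ hve₀
      have := hM1 x he₀
      rw [card_eq_zero.1 hc] at this
      simp at this
    · obtain ⟨a, ha⟩ := card_eq_one.1 hc
      refine hF.of_vertex hE hM1 fun s hsum x hx => ?_
      have hxa : x = a := by simpa [ha] using hx
      subst hxa
      rw [ha, sum_singleton, smul_eq_zero, sub_eq_zero] at hsum
      exact hsum.resolve_right fun h => hvM x hx (hp.injective h)
    · obtain ⟨a, b, hab, hM⟩ := card_eq_two.1 hc
      have hva := hvM a (by simp [hM])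
      have hvb := hvM b (by simp [hM])
      refine hF.of_vertex hE hM1 fun s hsum => ?_
      rw [hM, sum_pair hab] at hsum
      have := eq_zero_of_smul_add_smul_eq_zero (fun h => hp.det_ne_zero hva hvb hab (by
        simp only [PiLp.sub_apply] at h
        linear_combination h)) hsum
      simpa [hM] using this
    · obtain ⟨a, b, c, hab, hac, hbc, hM⟩ := card_eq_three.1 hc
      have haM : a ∈ M := by simp [hM]
      have hbM : b ∈ M := by simp [hM]
      have hcM : c ∈ M := by simp [hM]
      rcases hs.exists_reduction (hvM a haM) (hvM b hbM) (hvM c hcM) hab hac hbc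
        ((hmem a).1 haM) ((hmem b).1 hbM) ((hmem c).1 hcM) with h | h | h
      · exact ext1 a b c hM hab hac hbc h.1 h.2
      · exact ext1 a c b (by rw [hM, pair_comm b c]) hac hab hbc.symm h.1 h.2
      · exact ext1 b c a (by rw [hM, insert_comm a b, pair_comm a c]) hbc hab.symm hac.symm h.1 h.2

end Henneberg

/-! ### From independence to rigidity under continuous motions. -/

section RigidityOfFrameworks

open Finset Matrix

variable {W : Type*} [Fintype W] [DecidableEq W]

lemma inner_plane (x y : Plane) : inner ℝ x y = x 0 * y 0 + x 1 * y 1 := by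
  simp [PiLp.inner_apply, Fin.sum_univ_two, mul_comm]

lemma dist_sq_plane (x y : Plane) : dist x y ^ 2 = (x 0 - y 0) ^ 2 + (x 1 - y 1) ^ 2 := by
  rw [EuclideanSpace.dist_eq, Real.sq_sqrt (by positivity)]
  simp [Fin.sum_univ_two, Real.dist_eq, sq_abs]

lemma dist_eq_dist_iff {x y x' y' : Plane} : dist x y = dist x' y' ↔
    (x 0 - y 0) ^ 2 + (x 1 - y 1) ^ 2 = (x' 0 - y' 0) ^ 2 + (x' 1 - y' 1) ^ 2 := by
  rw [← dist_sq_plane, ← dist_sq_plane, sq_eq_sq₀ dist_nonneg dist_nonneg]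

lemma mulVec_rigidityMatrix {E : Finset (Finset W)} (p y : W → Plane) {a b : W} (hab : a ≠ b)
    (he : {a, b} ∈ E) :
    (rigidityMatrix E (coords p) *ᵥ coords y) ⟨{a, b}, he⟩ =
      (p a 0 - p b 0) * (y a 0 - y b 0) + (p a 1 - p b 1) * (y a 1 - y b 1) := by
  have h1 : ∀ w : W, ∀ i : Fin 2, rigidityMatrix E (coords p) ⟨{a, b}, he⟩ (w, i) =
      (if w = a then p a i - p b i else 0) + (if w = b then p b i - p a i else 0) := by
    intro w i
    simp only [rigidityMatrix, coords]
    by_cases hwa : w = a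
    · subst hwa
      rw [sum_eq_single b]
      · simp [hab]
      · intro x _ hx
        refine if_neg fun h => hx ?_
        have : b ∈ ({w, x} : Finset W) := h ▸ by simp
        simpa [hab.symm, eq_comm] using this
      · simp
    · by_cases hwb : w = b
      · subst hwb
        rw [sum_eq_single a]
        · simp [hwa, pair_comm]
        · intro x _ hx
          refine if_neg fun h => hx ?_
          have : a ∈ ({w, x} : Finset W) := h ▸ by simp
          simpa [hab, eq_comm] using this
        · simp
      · rw [if_neg hwa, if_neg hwb, add_zero]
        refine sum_eq_zero fun x _ => if_neg fun h => ?_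
        have : w ∈ ({a, b} : Finset W) := h ▸ by simp
        simp [hwa, hwb] at this
  rw [mulVec, dotProduct, Fintype.sum_prod_type]
  simp only [h1, Fin.sum_univ_two, coords, add_mul, sum_add_distrib, ite_mul, zero_mul,
    sum_ite_eq', mem_univ, if_true]
  ring

/-- An edge of length zero would carry a nonzero self-stress by itself. -/
lemma Independent.ne {E : Finset (Finset W)} {p : W → Plane} (hp : Independent E p) {a b : W}
    (he : {a, b} ∈ E) : p a ≠ p b := by
  intro hab
  have h := hp (Pi.single {a, b} 1)
    (fun e hne => Pi.single_eq_of_ne (fun h : e = {a, b} => hne (h ▸ he)) 1) fun w => ?_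
  · simpa using congrFun h {a, b}
  · refine sum_eq_zero fun x _ => ?_
    by_cases hwx : ({w, x} : Finset W) = {a, b}
    · have hw : w ∈ ({a, b} : Finset W) := hwx ▸ by simp
      have hx : x ∈ ({a, b} : Finset W) := hwx ▸ by simp
      rw [mem_insert, mem_singleton] at hw hx
      have : p w = p x := by
        rcases hw with rfl | rfl <;> rcases hx with rfl | rfl <;> simp [hab]
      simp [this]
    · simp [Pi.single_eq_of_ne hwx]

/-- The infinitesimal isometry with translation part `(c 0, c 1)` and angular velocity `c 2`. -/
def infinitesimalIsometry (p : W → Plane) : (Fin 3 → ℝ) →ₗ[ℝ] (W × Fin 2 → ℝ) where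
  toFun c a := if a.2 = 0 then c 0 - c 2 * p a.1 1 else c 1 + c 2 * p a.1 0
  map_add' c d := by
    funext a
    simp only [Pi.add_apply]
    split_ifs <;> ring
  map_smul' r c := by
    funext a
    simp only [Pi.smul_apply, smul_eq_mul, RingHom.id_apply]
    split_ifs <;> ring

/-- An independent edge set with `2 * |W| - 3` edges is infinitesimally rigid. -/
lemma Independent.infinitesimally_rigid {E : Finset (Finset W)} {p : W → Plane}
    (hp : Independent E p) (hE : ∀ e ∈ E, #e = 2) (hcard : #E + 3 = 2 * Fintype.card W)
    (hW : 2 ≤ Fintype.card W) {y : W → Plane}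
    (hy : ∀ a b, {a, b} ∈ E →
      (p a 0 - p b 0) * (y a 0 - y b 0) + (p a 1 - p b 1) * (y a 1 - y b 1) = 0) (a b : W) :
    (p a 0 - p b 0) * (y a 0 - y b 0) + (p a 1 - p b 1) * (y a 1 - y b 1) = 0 := by
  set A := rigidityMatrix E (coords p) with hA
  have hker : ∀ z : W → Plane, (∀ a b, {a, b} ∈ E →
      (p a 0 - p b 0) * (z a 0 - z b 0) + (p a 1 - p b 1) * (z a 1 - z b 1) = 0) →
      coords z ∈ LinearMap.ker A.mulVecLin := by
    intro z hz
    rw [LinearMap.mem_ker, mulVecLin_apply]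
    funext ⟨e, he⟩
    obtain ⟨c, d, hcd, rfl⟩ := card_eq_two.1 (hE e he)
    rw [mulVec_rigidityMatrix p z hcd he, hz c d he]
    rfl
  have hrow : LinearIndependent ℝ A.row := by
    rw [← vecMul_injective_iff, ← coe_vecMulLinear, ← LinearMap.ker_eq_bot, LinearMap.ker_eq_bot']
    exact fun l hl => independent_iff_vecMul.1 hp l hl
  have hrank : A.rank = #E := by rw [hrow.rank_matrix, Fintype.card_coe]
  -- Rank-nullity with `2 * |W|` columns and rank `2 * |W| - 3`. The infinitesimal isometries form a
  -- three-dimensional subspace of the kernel, as `p c ≠ p d`, and therefore fill it.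
  have hfin : Module.finrank ℝ (LinearMap.ker A.mulVecLin) = 3 := by
    have h1 := LinearMap.finrank_range_add_finrank_ker A.mulVecLin
    rw [← rank, hrank, Module.finrank_fintype_fun_eq_card, Fintype.card_prod, Fintype.card_fin] at h1
    omega
  obtain ⟨e, he⟩ : E.Nonempty := card_pos.1 (by have := hW; omega)
  obtain ⟨c, d, hcd, rfl⟩ := card_eq_two.1 (hE e he)
  have hpcd := hp.ne he
  let T : (Fin 3 → ℝ) →ₗ[ℝ] LinearMap.ker A.mulVecLin :=
    (infinitesimalIsometry p).codRestrict _ fun r => by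
      have h1 : infinitesimalIsometry p r =
          coords (fun w => !₂[r 0 - r 2 * p w 1, r 1 + r 2 * p w 0]) := by
        funext ⟨w, i⟩
        fin_cases i <;> simp [infinitesimalIsometry, coords]
      rw [h1]
      refine hker _ fun a b _ => ?_
      simp
      ring
  have hTinj : Function.Injective T := by
    rw [← LinearMap.ker_eq_bot, LinearMap.ker_eq_bot']
    intro r hr
    have hr' : ∀ x, infinitesimalIsometry p r x = 0 := fun x =>
      congrFun (congrArg Subtype.val hr) x
    have c0 := hr' (c, 0)
    have c1 := hr' (c, 1)
    have d0 := hr' (d, 0)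
    have d1 := hr' (d, 1)
    simp [infinitesimalIsometry] at c0 c1 d0 d1
    have h2 : r 2 = 0 := by
      by_contra hne
      refine hpcd ?_
      ext i
      fin_cases i
      · exact mul_left_cancel₀ hne (show r 2 * p c 0 = r 2 * p d 0 by linarith)
      · exact mul_left_cancel₀ hne (show r 2 * p c 1 = r 2 * p d 1 by linarith)
    rw [h2] at c0 c1
    funext i
    fin_cases i
    · simpa using c0
    · simpa using c1
    · exact h2
  have hTsurj : Function.Surjective T :=
    (LinearMap.injective_iff_surjective_of_finrank_eq_finrank (by rw [hfin]; simp)).1 hTinj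
  obtain ⟨r, hr⟩ := hTsurj ⟨coords y, hker y hy⟩
  have hr' : ∀ x, infinitesimalIsometry p r x = coords y x := fun x =>
    congrFun (congrArg Subtype.val hr) x
  have a0 := hr' (a, 0)
  have a1 := hr' (a, 1)
  have b0 := hr' (b, 0)
  have b1 := hr' (b, 1)
  simp [infinitesimalIsometry, coords] at a0 a1 b0 b1
  rw [← a0, ← a1, ← b0, ← b1]
  ring

/-- By polarisation, the squared norm of the resultant force at a vertex depends only on pairwise
distances, so congruent realisations have the same self-stresses. -/
lemma Independent.congr {E : Finset (Finset W)} {p q : W → Plane} (hp : Independent E p)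
    (h : ∀ a b, dist (p a) (p b) = dist (q a) (q b)) : Independent E q := by
  intro l hl hs
  refine hp l hl fun w => ?_
  have key : ∀ r : W → Plane,
      inner ℝ (∑ x, l {w, x} • (r w - r x)) (∑ x, l {w, x} • (r w - r x)) =
      ∑ x, ∑ y, l {w, x} * (l {w, y} *
        ((dist (r w) (r x) ^ 2 + dist (r w) (r y) ^ 2 - dist (r x) (r y) ^ 2) / 2)) := by
    intro r
    simp_rw [sum_inner, inner_sum, real_inner_smul_left, real_inner_smul_right]
    refine sum_congr rfl fun x _ => sum_congr rfl fun y _ => ?_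
    rw [inner_plane, dist_sq_plane, dist_sq_plane, dist_sq_plane]
    simp only [PiLp.sub_apply]
    ring
  rw [← inner_self_eq_zero (𝕜 := ℝ), key]
  simp_rw [h]
  rw [← key, hs w, inner_zero_left]

/-- A graph that contains a spanning sparse set of `2 * |W| - 3` edges is rigid. -/
theorem isRigid_of_isSparse {G : SimpleGraph W} {E : Finset (Finset W)} (hs : IsSparse E)
    (hE : ∀ e ∈ E, #e = 2) (hEG : ∀ a b, {a, b} ∈ E → G.Adj a b)
    (hcard : #E + 3 = 2 * Fintype.card W) (hW : 2 ≤ Fintype.card W) : IsRigid G := by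
  rintro p hp ⟨φ, hφ, hnt⟩
  refine hnt ?_
  have hind : Independent E p :=
    hs.independent_of_card_le hp _ hE le_rfl (fun e _ => subset_univ e)
  let I := Set.Ioo (-1 : ℝ) 1
  -- The times at which the motion is still congruent to `p` form a closed set containing 0;
  -- openness makes it the whole interval.
  let T : Set I := {t | ∀ a b, dist (p a) (p b) = dist (φ t a) (φ t b)}
  have hcont : Continuous fun t : I => φ t := hφ.continuousOn.domRestrict
  have hconta : ∀ a, Continuous fun t : I => φ t a := fun a => (continuous_apply a).comp hcont
  have hclosed : IsClosed T := by
    simp only [T, Set.ofPred_forall]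
    exact isClosed_iInter fun a => isClosed_iInter fun b =>
      isClosed_eq continuous_const ((hconta a).dist (hconta b))
  have hopen : IsOpen T := by
    rw [isOpen_iff_eventually]
    intro t₀ ht₀
    have hind₀ : Independent E (φ t₀) := hind.congr ht₀
    -- Averaging: since `|x|² - |y|² = ⟨x + y, x - y⟩`, the difference `φ t - φ t₀` is an
    -- infinitesimal motion of the midpoint realisation, and the same identity returns equal
    -- distances from infinitesimal rigidity. For `t` near `t₀` the midpoint is close to `φ t₀`,
    -- hence independent.
    let m : I → W → Plane := fun t a => (1 / 2 : ℝ) • (φ t a + φ t₀ a)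
    have hm : Continuous m := continuous_pi fun a => by
      have h1 : Continuous fun t : I => φ t a + φ t₀ a := (hconta a).add continuous_const
      exact h1.const_smul (1 / 2 : ℝ)
    have hm₀ : m t₀ = φ t₀ := by
      funext a
      simp only [m]
      module
    have hev : ∀ᶠ t in nhds t₀, Independent E (m t) :=
      hm.continuousAt.eventually_mem ((isOpen_independent E).mem_nhds (by rw [hm₀]; exact hind₀))
    filter_upwards [hev] with t ht a b
    rw [ht₀ a b, dist_eq_dist_iff]
    have hflex := ht.infinitesimally_rigid hE hcard hW (y := fun a => φ t a - φ t₀ a) (fun c d hcd => by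
      have h1 := hφ.equivalent t t.2 c d (hEG c d hcd)
      rw [hφ.equivalent t₀ t₀.2 c d (hEG c d hcd), dist_eq_dist_iff] at h1
      simp [m]
      linear_combination -(1 / 2) * h1) a b
    simp [m] at hflex
    linear_combination -2 * hflex
  have huniv : T = Set.univ := by
    have : PreconnectedSpace I := Subtype.preconnectedSpace isPreconnected_Ioo
    refine IsClopen.eq_univ ⟨hclosed, hopen⟩ ⟨⟨0, by norm_num, by norm_num⟩, fun a b => ?_⟩
    simp [hφ.start]
  intro t ht a b
  have h1 : (⟨t, ht⟩ : I) ∈ T := huniv ▸ Set.mem_univ _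
  have h2 := h1 a b
  rw [edist_dist, edist_dist, h2]

end RigidityOfFrameworks

/-! ### The body system of a flexible graph. -/

section Bodies

open Finset

lemma spread_eq_card_filter {V : Type*} [DecidableEq V] {E : Finset (Finset V)}
    (hE : ∀ e ∈ E, #e = 2) (X : Finset V) : spread E X = #(E.filter (· ⊆ X)) := by
  rw [card_filter]
  refine sum_congr rfl fun e he => ?_
  have h2 := hE e he
  split_ifs with h
  · rw [inter_eq_left.2 h, h2]
  · have := card_lt_card (Finset.ssubset_iff_subset_ne.2
      ⟨inter_subset_left, fun h' => h (inter_eq_left.1 h')⟩ : e ∩ X ⊂ e)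
    omega

/-- The edges in `E` that are spanned by the image of an embedding. -/
def pullback {V W : Type*} [DecidableEq V] [Fintype W] [DecidableEq W] (f : W ↪ V)
    (E : Finset (Finset V)) : Finset (Finset W) :=
  univ.filter fun e => e.map f ∈ E

lemma IsSparse.pullback {V W : Type*} [DecidableEq V] [Fintype W] [DecidableEq W] (f : W ↪ V)
    {E : Finset (Finset V)} (hs : IsSparse E) : IsSparse (pullback f E) := by
  intro Y hY
  have h := hs (Y.map f) (by rwa [card_map])
  rw [card_map] at h
  refine le_trans (Nat.add_le_add_right ?_ 3) h
  have h1 : spread (FlexGraph.pullback f E) Y =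
      spread ((FlexGraph.pullback f E).map (mapEmbedding f).toEmbedding) (Y.map f) := by
    rw [spread, spread, sum_map]
    refine sum_congr rfl fun e _ => ?_
    simp [← map_inter]
  rw [h1]
  refine spread_mono_left (fun e he => ?_) _
  obtain ⟨e', he', rfl⟩ := mem_map.1 he
  exact (mem_filter.1 he').2

lemma card_pullback {V W : Type*} [DecidableEq V] [Fintype W] [DecidableEq W] (f : W ↪ V)
    {E : Finset (Finset V)} (hE : ∀ e ∈ E, #e = 2) :
    #(pullback f E) = spread E (univ.map f) := by
  rw [spread_eq_card_filter hE, ← card_map (mapEmbedding f).toEmbedding]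
  congr 1
  ext e
  simp only [mem_map, pullback, mem_filter, mem_univ, true_and, RelEmbedding.coe_toEmbedding,
    mapEmbedding_apply]
  constructor
  · rintro ⟨e', he', rfl⟩
    exact ⟨he', map_subset_map.2 (subset_univ _)⟩
  · rintro ⟨he, hsub⟩
    obtain ⟨u, -, rfl⟩ := subset_map_iff.1 hsub
    exact ⟨u, he, rfl⟩

lemma pair_eq_pair_adj {V : Type*} [DecidableEq V] {G : SimpleGraph V} {a b c d : V}
    (h : ({a, b} : Finset V) = {c, d}) (hadj : G.Adj c d) : G.Adj a b := by
  have h1 : s(a, b) = s(c, d) := by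
    have := congrArg (fun s : Finset V => (s : Set V)) h
    simp only [coe_insert, coe_singleton] at this
    rw [Sym2.eq_iff]
    exact Set.pair_eq_pair_iff.1 this
  rwa [← SimpleGraph.mem_edgeSet, h1, SimpleGraph.mem_edgeSet]

/-- The subgraph induced by a tight set of edges is rigid. -/
lemma IsTight.isRigid {V : Type*} [Finite V] [DecidableEq V] {G : SimpleGraph V}
    {E : Finset (Finset V)} (hs : IsSparse E) (hE : ∀ e ∈ E, ∃ a b, G.Adj a b ∧ e = {a, b})
    {X : Finset V} (hX : IsTight E X) :
    IsRigid ((⊤ : G.Subgraph).induce (X : Set V)).coe := by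
  classical
  have := Fintype.ofFinite ((⊤ : G.Subgraph).induce (X : Set V)).verts
  have hE2 : ∀ e ∈ E, #e = 2 := by
    intro e he
    obtain ⟨a, b, hab, rfl⟩ := hE e he
    exact card_pair hab.ne
  let f : ((⊤ : G.Subgraph).induce (X : Set V)).verts ↪ V := Function.Embedding.subtype _
  have hXf : univ.map f = X := by
    ext x
    simp [f]
  have hcard : Fintype.card ((⊤ : G.Subgraph).induce (X : Set V)).verts = #X := by
    have h := congrArg Finset.card hXf
    rwa [card_map, card_univ] at h
  refine isRigid_of_isSparse (hs.pullback f) ?_ ?_ ?_ (by rw [hcard]; exact hX.1)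
  · intro e he
    rw [← hE2 _ (mem_filter.1 he).2, card_map]
  · intro a b hab
    obtain ⟨c, d, hcd, h⟩ := hE _ (mem_filter.1 hab).2
    have h2 : G.Adj a b := pair_eq_pair_adj (by simpa [f] using h) hcd
    exact ⟨a.2, b.2, h2⟩
  · rw [card_pullback f hE2, hXf, hcard, hX.2]

/-- A saturated system of vertex sets which induce rigid subgraphs and cover the edges. -/
structure IsBodySystem {V : Type*} [DecidableEq V] (G : SimpleGraph V) (𝓑 : Finset (Finset V)) :
    Prop extends IsSaturated 𝓑 where
  exists_mem : ∀ a b, G.Adj a b → ∃ B ∈ 𝓑, a ∈ B ∧ b ∈ B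
  exists_adj : ∀ B ∈ 𝓑, ∃ a ∈ B, ∃ b ∈ B, G.Adj a b
  isRigid : ∀ B ∈ 𝓑, IsRigid ((⊤ : G.Subgraph).induce (B : Set V)).coe

/-- The bodies are the maximal tight sets of a maximal sparse edge set `E`. By maximality, an edge
that cannot be added to `E` has both ends in a tight set. If the whole vertex set were tight, `E`
would have `2 * |V| - 3` edges and `G` would be rigid. -/
lemma exists_isBodySystem {V : Type*} [Fintype V] [DecidableEq V] (G : SimpleGraph V)
    (hG : IsFlexible G) : ∃ 𝓑, IsBodySystem G 𝓑 ∧ univ ∉ 𝓑 := by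
  classical
  let P : Finset (Finset V) → Prop := fun E =>
    IsSparse E ∧ ∀ e ∈ E, ∃ a b, G.Adj a b ∧ e = {a, b}
  have hP : P ∅ := ⟨fun X hX => by simp [spread]; omega, by simp⟩
  obtain ⟨E, -, hE⟩ := (Set.toFinite {E | P E}).exists_le_maximal hP
  have hs : IsSparse E := hE.1.1
  have hEG := hE.1.2
  have hE2 : ∀ e ∈ E, #e = 2 := by
    intro e he
    obtain ⟨a, b, hab, rfl⟩ := hEG e he
    exact card_pair hab.ne
  refine ⟨components E, ⟨isSaturated_components hs, ?_, ?_, ?_⟩, ?_⟩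
  · intro a b hab
    rcases hs.insert_pair_or hab.ne with ⟨h1, h2⟩ | ⟨T, hT, haT, hbT⟩
    · refine absurd (hE.2 (y := insert {a, b} E) ⟨h2, fun e he => ?_⟩ (subset_insert _ _)
        (mem_insert_self _ _)) h1
      rcases mem_insert.1 he with rfl | he
      · exact ⟨a, b, hab, rfl⟩
      · exact hEG e he
    · obtain ⟨R, hR, hTR⟩ := exists_mem_components hT
      exact ⟨R, hR, hTR haT, hTR hbT⟩
  · intro B hB
    have hBt := (mem_components.1 hB).1
    have h1 := hBt.2
    have h2 := hBt.1
    rw [spread_eq_card_filter hE2] at h1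
    obtain ⟨e, he⟩ := card_pos.1 (by omega : 0 < #(E.filter (· ⊆ B)))
    rw [mem_filter] at he
    obtain ⟨a, b, hab, rfl⟩ := hEG e he.1
    exact ⟨a, he.2 (by simp), b, he.2 (by simp), hab⟩
  · intro B hB
    exact (mem_components.1 hB).1.isRigid hs hEG
  · intro huniv
    have ht := (mem_components.1 huniv).1
    have h1 := ht.2
    rw [spread_eq_card_filter hE2, filter_true_of_mem fun e _ => subset_univ e, card_univ] at h1
    refine hG (isRigid_of_isSparse hs hE2 (fun a b hab => ?_) h1 ht.1)
    obtain ⟨c, d, hcd, h⟩ := hEG _ hab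
    exact pair_eq_pair_adj h hcd

end Bodies

/-! ### Gluing rigid subgraphs along two vertices. -/

section Gluing

/-- The signed area of a continuously moving triangle with constant side lengths is constant. -/
lemma det_eq_of_dist_eq {a b x : ℝ → Plane} {s : Set ℝ} (hs : IsPreconnected s) {t₀ : ℝ}
    (ht₀ : t₀ ∈ s) (ha : ContinuousOn a s) (hb : ContinuousOn b s) (hx : ContinuousOn x s)
    (hab : ∀ t ∈ s, dist (a t) (b t) = dist (a t₀) (b t₀))
    (hax : ∀ t ∈ s, dist (a t) (x t) = dist (a t₀) (x t₀))
    (hbx : ∀ t ∈ s, dist (b t) (x t) = dist (b t₀) (x t₀)) {t : ℝ} (ht : t ∈ s) :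
    (b t 0 - a t 0) * (x t 1 - a t 1) - (b t 1 - a t 1) * (x t 0 - a t 0) =
    (b t₀ 0 - a t₀ 0) * (x t₀ 1 - a t₀ 1) - (b t₀ 1 - a t₀ 1) * (x t₀ 0 - a t₀ 0) := by
  set f : ℝ → ℝ := fun t =>
    (b t 0 - a t 0) * (x t 1 - a t 1) - (b t 1 - a t 1) * (x t 0 - a t 0) with hf
  have hcoord : ∀ {y : ℝ → Plane}, ContinuousOn y s → ∀ i, ContinuousOn (fun t => y t i) s :=
    fun hy i => (EuclideanSpace.proj (𝕜 := ℝ) i).continuous.comp_continuousOn hy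
  have hfc : ContinuousOn f s := by
    have a0 := hcoord ha 0
    have a1 := hcoord ha 1
    have b0 := hcoord hb 0
    have b1 := hcoord hb 1
    have x0 := hcoord hx 0
    have x1 := hcoord hx 1
    exact ((b0.sub a0).mul (x1.sub a1)).sub ((b1.sub a1).mul (x0.sub a0))
  have hsq : ∀ t ∈ s, f t ^ 2 = f t₀ ^ 2 := by
    intro t ht
    have h1 := dist_eq_dist_iff.1 (hab t ht)
    have h2 := dist_eq_dist_iff.1 (hax t ht)
    have h3 := dist_eq_dist_iff.1 (hbx t ht)
    -- Heron's formula: the side lengths fix the area up to sign, and continuity on a connected set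
    -- excludes a change of sign.
    have heron : ∀ r, 4 * f r ^ 2 =
        4 * (((a r 0 - b r 0) ^ 2 + (a r 1 - b r 1) ^ 2) *
          ((a r 0 - x r 0) ^ 2 + (a r 1 - x r 1) ^ 2)) -
        (((a r 0 - b r 0) ^ 2 + (a r 1 - b r 1) ^ 2) +
          ((a r 0 - x r 0) ^ 2 + (a r 1 - x r 1) ^ 2) -
          ((b r 0 - x r 0) ^ 2 + (b r 1 - x r 1) ^ 2)) ^ 2 := by
      intro r
      simp only [hf]
      ring
    have h4 := heron t
    rw [h1, h2, h3, ← heron t₀] at h4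
    linarith
  change f t = f t₀
  by_cases h0 : f t₀ = 0
  · have := hsq t ht
    rw [h0] at this ⊢
    exact pow_eq_zero_iff (two_ne_zero) |>.1 (by simpa using this)
  · rcases hs.eq_or_eq_neg_of_sq_eq hfc (continuousOn_const (c := f t₀))
      (fun r hr => by simpa using hsq r hr) (fun _ => h0) with h | h
    · exact h ht
    · have := h ht₀
      simp only [Pi.neg_apply] at this
      exact absurd (by linarith) h0

/-- Two points in the plane are determined up to isometry by their relation to a segment. -/
lemma dist_eq_of_det_eq {a b x y a' b' x' y' : Plane} (hne : a ≠ b)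
    (hab : dist a b = dist a' b') (hax : dist a x = dist a' x') (hbx : dist b x = dist b' x')
    (hay : dist a y = dist a' y') (hby : dist b y = dist b' y')
    (hdx : (b 0 - a 0) * (x 1 - a 1) - (b 1 - a 1) * (x 0 - a 0) =
      (b' 0 - a' 0) * (x' 1 - a' 1) - (b' 1 - a' 1) * (x' 0 - a' 0))
    (hdy : (b 0 - a 0) * (y 1 - a 1) - (b 1 - a 1) * (y 0 - a 0) =
      (b' 0 - a' 0) * (y' 1 - a' 1) - (b' 1 - a' 1) * (y' 0 - a' 0)) :
    dist x y = dist x' y' := by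
  have hD : (a 0 - b 0) ^ 2 + (a 1 - b 1) ^ 2 ≠ 0 := by
    rw [← dist_sq_plane]
    exact pow_ne_zero 2 (dist_ne_zero.2 hne)
  rw [dist_eq_dist_iff] at *
  have ix : (b 0 - a 0) * (x 0 - a 0) + (b 1 - a 1) * (x 1 - a 1) =
      (b' 0 - a' 0) * (x' 0 - a' 0) + (b' 1 - a' 1) * (x' 1 - a' 1) := by
    linear_combination (1 / 2) * (hab + hax - hbx)
  have iy : (b 0 - a 0) * (y 0 - a 0) + (b 1 - a 1) * (y 1 - a 1) =
      (b' 0 - a' 0) * (y' 0 - a' 0) + (b' 1 - a' 1) * (y' 1 - a' 1) := by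
    linear_combination (1 / 2) * (hab + hay - hby)
  have key : (x 0 - a 0) * (y 0 - a 0) + (x 1 - a 1) * (y 1 - a 1) =
      (x' 0 - a' 0) * (y' 0 - a' 0) + (x' 1 - a' 1) * (y' 1 - a' 1) := by
    -- Lagrange's identity expresses the inner product of `x - a` and `y - a` by components along
    -- and across the segment `ab`.
    have lag : ∀ a b x y : Plane, ((a 0 - b 0) ^ 2 + (a 1 - b 1) ^ 2) *
        ((x 0 - a 0) * (y 0 - a 0) + (x 1 - a 1) * (y 1 - a 1)) =
        ((b 0 - a 0) * (x 0 - a 0) + (b 1 - a 1) * (x 1 - a 1)) *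
          ((b 0 - a 0) * (y 0 - a 0) + (b 1 - a 1) * (y 1 - a 1)) +
        ((b 0 - a 0) * (x 1 - a 1) - (b 1 - a 1) * (x 0 - a 0)) *
          ((b 0 - a 0) * (y 1 - a 1) - (b 1 - a 1) * (y 0 - a 0)) := by
      intros
      ring
    refine mul_left_cancel₀ hD ?_
    rw [lag, ix, iy, hdx, hdy, ← lag, hab]
  linear_combination hax + hay - 2 * key

variable {V : Type*} {G : SimpleGraph V}

lemma IsGeneric.comp {V W : Type*} {p : V → Plane} (hp : IsGeneric p) {f : W → V}
    (hf : Function.Injective f) : IsGeneric (p ∘ f) :=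
  AlgebraicIndependent.comp hp (fun x : W × Fin 2 => (f x.1, x.2))
    (fun _ _ h => Prod.ext (hf (congrArg Prod.fst h)) (congrArg (fun z : V × Fin 2 => z.2) h))

/-- A motion of a generic realisation preserves the distances within a rigid subgraph. -/
lemma IsRigid.dist_eq {H K : G.Subgraph} (hH : IsRigid H.coe) (hHK : H ≤ K)
    {p : K.verts → Plane} (hp : IsGeneric p) {φ : ℝ → K.verts → Plane}
    (hφ : IsContinuousMotion K.coe p φ) {t : ℝ} (ht : t ∈ Set.Ioo (-1 : ℝ) 1) {x y : V}
    (hx : x ∈ H.verts) (hy : y ∈ H.verts) :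
    dist (φ t ⟨x, hHK.1 hx⟩) (φ t ⟨y, hHK.1 hy⟩) =
      dist (p ⟨x, hHK.1 hx⟩) (p ⟨y, hHK.1 hy⟩) := by
  have hf := SimpleGraph.Subgraph.inclusion.injective hHK
  have h1 := hH _ (hp.comp hf)
  have h2 : IsTrivialMotion (p ∘ SimpleGraph.Subgraph.inclusion hHK)
      (fun t => φ t ∘ SimpleGraph.Subgraph.inclusion hHK) := by
    by_contra hnt
    refine h1 ⟨_, ⟨?_, ?_, ?_⟩, hnt⟩
    · exact continuousOn_pi.2 fun v => continuousOn_pi.1 hφ.continuousOn _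
    · simp [hφ.start]
    · exact fun t ht _ _ huv => hφ.equivalent t ht _ _
        ((SimpleGraph.Subgraph.inclusion hHK).map_adj huv)
  have h3 := h2 t ht ⟨x, hx⟩ ⟨y, hy⟩
  rw [edist_dist, edist_dist, ENNReal.ofReal_eq_ofReal_iff dist_nonneg dist_nonneg] at h3
  exact h3.symm

/-- The union of two rigid subgraphs with two common vertices is rigid. -/
theorem IsRigid.sup {H K : G.Subgraph} (hH : IsRigid H.coe) (hK : IsRigid K.coe) {u v : V}
    (huv : u ≠ v) (huH : u ∈ H.verts) (hvH : v ∈ H.verts) (huK : u ∈ K.verts)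
    (hvK : v ∈ K.verts) : IsRigid (H ⊔ K).coe := by
  rintro p hp ⟨φ, hφ, hnt⟩
  refine hnt fun t ht => ?_
  have h0 : (0 : ℝ) ∈ Set.Ioo (-1 : ℝ) 1 := by norm_num
  have hc : ∀ x, ContinuousOn (fun t => φ t x) (Set.Ioo (-1 : ℝ) 1) :=
    fun x => continuousOn_pi.1 hφ.continuousOn x
  have mem : ∀ x : (H ⊔ K).verts, (x : V) ∈ H.verts ∨ (x : V) ∈ K.verts := fun x => x.2
  have dH : ∀ x y : (H ⊔ K).verts, (x : V) ∈ H.verts → (y : V) ∈ H.verts →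
      ∀ t ∈ Set.Ioo (-1 : ℝ) 1, dist (φ t x) (φ t y) = dist (φ 0 x) (φ 0 y) := by
    intro x y hx hy t ht
    rw [hφ.start]
    exact hH.dist_eq le_sup_left hp hφ ht hx hy
  have dK : ∀ x y : (H ⊔ K).verts, (x : V) ∈ K.verts → (y : V) ∈ K.verts →
      ∀ t ∈ Set.Ioo (-1 : ℝ) 1, dist (φ t x) (φ t y) = dist (φ 0 x) (φ 0 y) := by
    intro x y hx hy t ht
    rw [hφ.start]
    exact hK.dist_eq le_sup_right hp hφ ht hx hy
  let a : (H ⊔ K).verts := ⟨u, Or.inl huH⟩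
  let b : (H ⊔ K).verts := ⟨v, Or.inl hvH⟩
  have hab : p a ≠ p b := fun h => huv (congrArg Subtype.val (hp.injective h))
  -- The vertices `a` and `b` belong to both parts, so every vertex keeps its distances to them,
  -- whichever part contains it.
  have dax : ∀ x, ∀ t ∈ Set.Ioo (-1 : ℝ) 1, dist (φ t a) (φ t x) = dist (φ 0 a) (φ 0 x) := by
    intro x
    rcases mem x with hx | hx
    · exact dH a x huH hx
    · exact dK a x huK hx
  have dbx : ∀ x, ∀ t ∈ Set.Ioo (-1 : ℝ) 1, dist (φ t b) (φ t x) = dist (φ 0 b) (φ 0 x) := by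
    intro x
    rcases mem x with hx | hx
    · exact dH b x hvH hx
    · exact dK b x hvK hx
  intro x y
  rw [edist_dist, edist_dist, ← hφ.start]
  congr 1
  have hdet := fun z => det_eq_of_dist_eq isPreconnected_Ioo h0 (hc a) (hc b) (hc z)
    (dax b) (dax z) (dbx z) ht
  exact dist_eq_of_det_eq (by rwa [hφ.start]) (dax b t ht).symm (dax x t ht).symm
    (dbx x t ht).symm (dax y t ht).symm (dbx y t ht).symm (hdet x).symm (hdet y).symm

/-- A graph without edges and with at least two vertices is not rigid. -/
lemma not_isRigid_of_forall_not_adj {W : Type*} {H : SimpleGraph W} (hH : ∀ x y, ¬ H.Adj x y)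
    {u v : W} (huv : u ≠ v) {p : W → Plane} (hp : IsGeneric p) : ¬ IsRigid H := by
  classical
  intro h
  let e : Plane := EuclideanSpace.single 0 1
  refine h p hp ⟨fun t => Function.update p u (p u + t • e), ⟨?_, ?_, ?_⟩, ?_⟩
  · exact (continuous_const.update u (by fun_prop)).continuousOn
  · simp
  · exact fun _ _ x y hxy => absurd hxy (hH x y)
  · intro ht
    -- Moving `u` horizontally by `t` would have to preserve its distance to `v`; the times `1/2`
    -- and `-1/2` give contradictory values of `p u 0 - p v 0`.
    have key : ∀ t ∈ Set.Ioo (-1 : ℝ) 1, t * (2 * (p u 0 - p v 0) + t) = 0 := by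
      intro t hmem
      have h1 := ht t hmem u v
      rw [edist_dist, edist_dist, ENNReal.ofReal_eq_ofReal_iff dist_nonneg dist_nonneg,
        dist_eq_dist_iff] at h1
      simp [huv.symm, e] at h1
      linear_combination -h1
    have h1 := key (1 / 2) (by norm_num)
    have h2 := key (-1 / 2) (by constructor <;> norm_num)
    linarith

end Gluing

/-! ### Comparing rigid components with bodies. -/

section RigidComponents

variable {V : Type*} [DecidableEq V] {G : SimpleGraph V}

/-- Every rigid component contains the subgraph induced by some body. -/
lemma IsBodySystem.exists_induce_le {𝓑 : Finset (Finset V)} (h𝓑 : IsBodySystem G 𝓑) [Nonempty V]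
    (hadj : ∀ v, ∃ w, G.Adj v w) (hG : IsFlexible G) {R : G.Subgraph}
    (hR : IsRigidComponent G R) : ∃ B ∈ 𝓑, (⊤ : G.Subgraph).induce (B : Set V) ≤ R := by
  by_cases hE : ∃ a b, R.Adj a b
  · obtain ⟨a, b, hab⟩ := hE
    obtain ⟨B, hB, ha, hb⟩ := h𝓑.exists_mem a b hab.adj_sub
    refine ⟨B, hB, le_sup_right.trans (hR.2 (hR.1.sup (h𝓑.isRigid B hB) hab.adj_sub.ne
      hab.fst_mem hab.snd_mem ha hb) le_sup_left)⟩
  · push Not at hE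
    have hsub : ∃ v, R.verts ⊆ {v} := by
      by_contra! hcon
      have hne : R.verts.Nontrivial := by
        rw [← Set.not_subsingleton_iff]
        intro hss
        rcases hss.eq_empty_or_singleton with h | ⟨v, h⟩
        · exact hcon (Classical.arbitrary V) (by simp [h])
        · exact hcon v h.le
      obtain ⟨x, hx, y, hy, hxy⟩ := hne
      -- Flexibility supplies a generic realisation; without one, rigidity would hold vacuously and
      -- say nothing about edgeless subgraphs.
      unfold IsFlexible IsRigid at hG
      push Not at hG
      obtain ⟨p, hp, -⟩ := hG
      exact not_isRigid_of_forall_not_adj (H := R.coe) (fun c d => hE c d)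
        (u := ⟨x, hx⟩) (v := ⟨y, hy⟩) (fun h => hxy (congrArg Subtype.val h))
        (hp.comp Subtype.val_injective) hR.1
    obtain ⟨v, hv⟩ := hsub
    obtain ⟨w, hvw⟩ := hadj v
    obtain ⟨B, hB, hvB, -⟩ := h𝓑.exists_mem v w hvw
    refine ⟨B, hB, hR.2 (h𝓑.isRigid B hB) ⟨fun x hx => ?_, fun x y hxy => absurd hxy (hE x y)⟩⟩
    rw [Set.mem_singleton_iff.1 (hv hx)]
    exact hvB

/-- There are at most as many rigid components as bodies. -/
theorem IsBodySystem.numRigidComponents_le [Finite V] {𝓑 : Finset (Finset V)} (h𝓑 : IsBodySystem G 𝓑)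
    [Nonempty V] (hadj : ∀ v, ∃ w, G.Adj v w) (hG : IsFlexible G) :
    numRigidComponents G ≤ 𝓑.card := by
  choose! f hf𝓑 hf using fun R (hR : IsRigidComponent G R) => h𝓑.exists_induce_le hadj hG hR
  rw [numRigidComponents, ← Set.ncard_coe_finset]
  refine Set.ncard_le_ncard_of_injOn f hf𝓑 ?_ 𝓑.finite_toSet
  intro R hR T hT hRT
  -- Components containing the same body share two vertices, so their union is rigid and maximality
  -- identifies them.
  obtain ⟨a, ha, b, hb, hab⟩ := h𝓑.exists_adj _ (hf𝓑 R hR)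
  have hs := hR.1.sup hT.1 hab.ne ((hf R hR).1 ha) ((hf R hR).1 hb)
    ((hf T hT).1 (show a ∈ f T from hRT ▸ ha)) ((hf T hT).1 (show b ∈ f T from hRT ▸ hb))
  exact le_antisymm (le_sup_left.trans (hT.2 hs le_sup_right))
    (le_sup_right.trans (hR.2 hs le_sup_left))

end RigidComponents

/-! ### Stable separations of bodies. -/

section StableSeparations

variable {V : Type*} {G : SimpleGraph V}

lemma IsStableSeparation.symm {G₁ G₂ : G.Subgraph} (h : IsStableSeparation G G₁ G₂) :
    IsStableSeparation G G₂ G₁ := by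
  obtain ⟨⟨⟨E₁, E₂, hu, hd, h1, h2⟩, hl, hr⟩, hS⟩ := h
  exact ⟨⟨⟨E₂, E₁, by rwa [Set.union_comm], hd.symm, h2, h1⟩, hr, hl⟩, by rwa [inf_comm]⟩

lemma IsStableSeparation.adj_right_iff {G₁ G₂ : G.Subgraph} (h : IsStableSeparation G G₁ G₂)
    {a b : V} (hab : G.Adj a b) : G₂.Adj a b ↔ ¬ G₁.Adj a b := by
  obtain ⟨⟨⟨E₁, E₂, hu, hd, rfl, rfl⟩, -, -⟩, -⟩ := h
  have hmem : s(a, b) ∈ E₁ ∪ E₂ := hu ▸ (SimpleGraph.mem_edgeSet G).2 hab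
  simp only [edgeInduced, hab, true_and]
  exact ⟨fun h2 h1 => Set.disjoint_left.1 hd h1 h2, fun h1 => hmem.resolve_left h1⟩

lemma IsStableSeparation.mem_left_iff {G₁ G₂ : G.Subgraph} (h : IsStableSeparation G G₁ G₂)
    {a : V} : a ∈ G₁.verts ↔ ∃ b, G₁.Adj a b := by
  obtain ⟨⟨⟨E₁, E₂, hu, hd, rfl, rfl⟩, -, -⟩, -⟩ := h
  rfl

lemma IsStableSeparation.ne {G₁ G₂ : G.Subgraph} (h : IsStableSeparation G G₁ G₂) : G₁ ≠ G₂ := by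
  rintro rfl
  obtain ⟨x, hx⟩ := h.1.2.1
  exact hx.2 hx.1

/-- A side of a separation is determined by its edges. -/
lemma IsStableSeparation.left_ext {G₁ G₂ K₁ K₂ : G.Subgraph} (h : IsStableSeparation G G₁ G₂)
    (h' : IsStableSeparation G K₁ K₂) (hadj : ∀ a b, G₁.Adj a b ↔ K₁.Adj a b) : G₁ = K₁ := by
  refine SimpleGraph.Subgraph.ext ?_ (funext fun a => funext fun b => propext (hadj a b))
  ext a
  rw [h.mem_left_iff, h'.mem_left_iff]
  simp only [hadj]

lemma IsStableSeparation.ext {G₁ G₂ K₁ K₂ : G.Subgraph} (h : IsStableSeparation G G₁ G₂)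
    (h' : IsStableSeparation G K₁ K₂)
    (hadj : ∀ a b, G.Adj a b → (G₁.Adj a b ↔ K₁.Adj a b)) : G₁ = K₁ ∧ G₂ = K₂ := by
  refine ⟨h.left_ext h' fun a b => ⟨fun hab => (hadj a b hab.adj_sub).1 hab,
    fun hab => (hadj a b hab.adj_sub).2 hab⟩, h.symm.left_ext h'.symm fun a b => ?_⟩
  have key : ∀ hab : G.Adj a b, (G₂.Adj a b ↔ K₂.Adj a b) := fun hab => by
    rw [h.adj_right_iff hab, h'.adj_right_iff hab, hadj a b hab]
  exact ⟨fun hab => (key hab.adj_sub).1 hab, fun hab => (key hab.adj_sub).2 hab⟩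

open Finset in
/-- Two bodies can be separated by a stable separation. -/
theorem IsBodySystem.exists_isStableSeparation [Fintype V] [DecidableEq V]
    {𝓑 : Finset (Finset V)} (h𝓑 : IsBodySystem G 𝓑) (hadj : ∀ v, ∃ w, G.Adj v w)
    {B D : Finset V} (hB : B ∈ 𝓑) (hD : D ∈ 𝓑) (hBD : B ≠ D) :
    ∃ G₁ G₂, IsStableSeparation G G₁ G₂ ∧
      (∀ a ∈ B, ∀ b ∈ B, G.Adj a b → G₁.Adj a b) ∧
      (∀ a ∈ D, ∀ b ∈ D, G.Adj a b → G₂.Adj a b) := by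
  have hDt : IsTight 𝓑 D := isTight_of_subset_mem h𝓑.sparse hD (h𝓑.two_le_card D hD) subset_rfl
  obtain ⟨u, huB, huD⟩ : ∃ u ∈ B, u ∉ D := by
    by_contra! hcon
    have h1 := h𝓑.card_inter_le_one hB hD hBD
    rw [inter_eq_left.2 hcon] at h1
    have h2 := h𝓑.two_le_card B hB
    omega
  obtain ⟨A, S, hAS, huA, hDA⟩ := exists_isStableSide (#(univ : Finset V)) h𝓑.sparse
    (N := univ) le_rfl (fun C _ => subset_univ C) (u := u) hDt (by
      intro T hT huT hDT
      obtain ⟨R, hR, hTR⟩ := h𝓑.exists_superset T hT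
      have h1 : D = R := by
        by_contra hne
        have h1 := h𝓑.card_inter_le_one hD hR hne
        rw [inter_eq_left.2 (hDT.trans hTR)] at h1
        have h2 := h𝓑.two_le_card D hD
        omega
      exact huD (h1 ▸ hTR huT))
  have hS : ∀ C ∈ 𝓑, ∀ a ∈ C, ∀ b ∈ C, a ∈ S → b ∈ S → a = b := by
    intro C hC a ha b hb haS hbS
    exact card_le_one.1 (hAS.card_inter_le_one C hC) a (mem_inter.2 ⟨ha, haS⟩) b
      (mem_inter.2 ⟨hb, hbS⟩)
  have hnbr : ∀ a b, G.Adj a b → a ∈ A → b ∈ A ∪ S := by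
    intro a b hab ha
    obtain ⟨C, hC, haC, hbC⟩ := h𝓑.exists_mem a b hab
    exact hAS.subset_union C hC a haC ha hbC
  -- `E₁` consists of the edges with an end in `A`. The common vertices of the two sides then lie in
  -- `S`, and no edge joins two vertices of `S`, because each edge lies in a body and a body meets
  -- `S` at most once.
  let E₁ : Set (Sym2 V) := {e | e ∈ G.edgeSet ∧ ∃ x ∈ e, x ∈ A}
  let E₂ : Set (Sym2 V) := {e | e ∈ G.edgeSet ∧ ¬ ∃ x ∈ e, x ∈ A}
  have adj₁ : ∀ a b, (edgeInduced G E₁).Adj a b ↔ G.Adj a b ∧ (a ∈ A ∨ b ∈ A) := by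
    intro a b
    simp [edgeInduced, E₁]
  have adj₂ : ∀ a b, (edgeInduced G E₂).Adj a b ↔ G.Adj a b ∧ a ∉ A ∧ b ∉ A := by
    intro a b
    simp [edgeInduced, E₂]
  have mem₁ : ∀ a, a ∈ (edgeInduced G E₁).verts ↔ ∃ b, (edgeInduced G E₁).Adj a b :=
    fun _ => Iff.rfl
  have mem₂ : ∀ a, a ∈ (edgeInduced G E₂).verts ↔ ∃ b, (edgeInduced G E₂).Adj a b :=
    fun _ => Iff.rfl
  have sub₁ : ∀ a ∈ (edgeInduced G E₁).verts, a ∈ A ∪ S := by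
    intro a ha
    obtain ⟨b, hb⟩ := (mem₁ a).1 ha
    obtain ⟨hab, h | h⟩ := (adj₁ a b).1 hb
    · exact mem_union_left _ h
    · exact hnbr b a hab.symm h
  have sub₂ : ∀ a ∈ (edgeInduced G E₂).verts, a ∉ A := by
    intro a ha
    obtain ⟨b, hb⟩ := (mem₂ a).1 ha
    exact ((adj₂ a b).1 hb).2.1
  have hDA' : ∀ a ∈ D, a ∉ A := fun a ha => Finset.disjoint_left.1 hDA ha
  refine ⟨edgeInduced G E₁, edgeInduced G E₂, ⟨⟨⟨E₁, E₂, ?_, ?_, rfl, rfl⟩, ?_, ?_⟩, ?_⟩, ?_, ?_⟩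
  · ext e
    exact ⟨fun h => h.elim And.left And.left,
      fun h => (Classical.em _).imp (And.intro h) (And.intro h)⟩
  · exact Set.disjoint_left.2 fun e h1 h2 => h2.2 h1.2
  · obtain ⟨w, huw⟩ := hadj u
    exact ⟨u, (mem₁ u).2 ⟨w, (adj₁ u w).2 ⟨huw, Or.inl huA⟩⟩, fun h => sub₂ u h huA⟩
  · obtain ⟨a, ha, b, hb, hab⟩ := h𝓑.exists_adj D hD
    have key : ∀ x ∈ D, ∀ y ∈ D, G.Adj x y → x ∉ S →
        x ∈ (edgeInduced G E₂).verts \ (edgeInduced G E₁).verts := by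
      intro x hx y hy hxy hxS
      refine ⟨(mem₂ x).2 ⟨y, (adj₂ x y).2 ⟨hxy, hDA' x hx, hDA' y hy⟩⟩, fun h => ?_⟩
      rcases mem_union.1 (sub₁ x h) with h | h
      · exact hDA' x hx h
      · exact hxS h
    by_cases haS : a ∈ S
    · exact ⟨b, key b hb a ha hab.symm fun hbS => hab.ne (hS D hD a ha b hb haS hbS)⟩
    · exact ⟨a, key a ha b hb hab haS⟩
  · rintro a ⟨ha₁, ha₂⟩ b ⟨hb₁, hb₂⟩ hne hab
    obtain ⟨C, hC, haC, hbC⟩ := h𝓑.exists_mem a b hab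
    exact hne (hS C hC a haC b hbC ((mem_union.1 (sub₁ a ha₁)).resolve_left (sub₂ a ha₂))
      ((mem_union.1 (sub₁ b hb₁)).resolve_left (sub₂ b hb₂)))
  · intro a ha b hb hab
    refine (adj₁ a b).2 ⟨hab, ?_⟩
    by_contra! hcon
    exact hab.ne (hS B hB a ha b hb
      ((mem_union.1 (hAS.subset_union B hB u huB huA ha)).resolve_left hcon.1)
      ((mem_union.1 (hAS.subset_union B hB u huB huA hb)).resolve_left hcon.2))
  · exact fun a ha b hb hab => (adj₂ a b).2 ⟨hab, hDA' a ha, hDA' b hb⟩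

/-- Every stable separation has an ordered representative. -/
lemma exists_isStableSeparation_out (G : SimpleGraph V) : ∃ f : Sym2 G.Subgraph →
    G.Subgraph × G.Subgraph, ∀ P ∈ {P : Sym2 G.Subgraph | ∃ G₁ G₂ : G.Subgraph, P = s(G₁, G₂) ∧
      IsStableSeparation G G₁ G₂}, P = s((f P).1, (f P).2) ∧
        IsStableSeparation G (f P).1 (f P).2 := by
  choose! g h hP using fun (P : Sym2 G.Subgraph) (hP : P ∈ {P : Sym2 G.Subgraph |
    ∃ G₁ G₂ : G.Subgraph, P = s(G₁, G₂) ∧ IsStableSeparation G G₁ G₂}) => hP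
  exact ⟨fun P => (g P, h P), hP⟩

open Finset in
/-- There are at least `log₂ m` stable separations if there are `m` bodies. -/
theorem IsBodySystem.card_le_two_pow [Fintype V] [DecidableEq V]
    {𝓑 : Finset (Finset V)} (h𝓑 : IsBodySystem G 𝓑) (hadj : ∀ v, ∃ w, G.Adj v w) :
    #𝓑 ≤ 2 ^ numStableSeparations G := by
  classical
  obtain ⟨f, hf⟩ := exists_isStableSeparation_out G
  set 𝓢 := {P : Sym2 G.Subgraph | ∃ G₁ G₂ : G.Subgraph, P = s(G₁, G₂) ∧
    IsStableSeparation G G₁ G₂} with h𝓢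
  have hfin : 𝓢.Finite := Set.toFinite _
  rw [numStableSeparations, ← h𝓢, Set.ncard_eq_toFinset_card 𝓢 hfin, ← card_powerset]
  -- A body is encoded by the separations whose chosen first side contains its edges; a separation
  -- that splits two bodies distinguishes their codes in either orientation.
  refine card_le_card_of_injOn (fun B => hfin.toFinset.filter
    fun P => ∀ a ∈ B, ∀ b ∈ B, G.Adj a b → (f P).1.Adj a b)
    (fun B _ => mem_powerset.2 (filter_subset _ _)) ?_
  intro B hB D hD heq
  by_contra hBD
  obtain ⟨G₁, G₂, hsep, h1, h2⟩ := h𝓑.exists_isStableSeparation hadj hB hD hBD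
  have hP : s(G₁, G₂) ∈ 𝓢 := ⟨G₁, G₂, rfl, hsep⟩
  have heq' : (∀ a ∈ B, ∀ b ∈ B, G.Adj a b → (f s(G₁, G₂)).1.Adj a b) ↔
      ∀ a ∈ D, ∀ b ∈ D, G.Adj a b → (f s(G₁, G₂)).1.Adj a b := by
    have h3 := Finset.ext_iff.1 heq s(G₁, G₂)
    simpa only [mem_filter, Set.Finite.mem_toFinset, hP, true_and] using h3
  obtain ⟨hPf, -⟩ := hf _ hP
  rcases Sym2.eq_iff.1 hPf with ⟨e1, -⟩ | ⟨-, e2⟩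
  · rw [← e1] at heq'
    obtain ⟨a, ha, b, hb, hab⟩ := h𝓑.exists_adj D hD
    exact (hsep.adj_right_iff hab).1 (h2 a ha b hb hab) (heq'.1 h1 a ha b hb hab)
  · rw [← e2] at heq'
    obtain ⟨a, ha, b, hb, hab⟩ := h𝓑.exists_adj B hB
    exact (hsep.adj_right_iff hab).1 (heq'.2 h2 a ha b hb hab) (h1 a ha b hb hab)

end StableSeparations

/-! ### NAC-colourings from stable separations. -/

section NACColourings

variable {V : Type*} {G : SimpleGraph V}

lemma Colour.eq_red_of_ne {a : Colour} (h : a ≠ .blue) : a = .red := by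
  cases a
  · rfl
  · exact absurd rfl h

lemma Colour.eq_blue_of_ne {a : Colour} (h : a ≠ .red) : a = .blue := by
  cases a
  · exact absurd rfl h
  · rfl

/-- The spanning subgraph formed by the edges of colour `a`. -/
def colourGraph (c : G.edgeSet → Colour) (a : Colour) : SimpleGraph V where
  Adj x y := ∃ h : G.Adj x y, c ⟨s(x, y), h⟩ = a
  symm := ⟨by
    rintro x y ⟨h, hc⟩
    refine ⟨h.symm, ?_⟩
    rw [← hc]
    congr 2
    exact Sym2.eq_swap⟩
  loopless := ⟨fun x h => h.1.ne rfl⟩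

/-- If a cycle has exactly one edge of colour `a`, the rest of it joins the ends of that edge in
colour `b`. -/
lemma monochromatic_or_two_le_ncard [Finite V] {c : G.edgeSet → Colour} {a b : Colour}
    (hba : ∀ d, d ≠ a → d = b)
    (h : ∀ x y (hxy : G.Adj x y), c ⟨s(x, y), hxy⟩ = a → ¬ (colourGraph c b).Reachable x y)
    {v : V} {w : G.Walk v v} (hw : w.IsCycle) :
    (∃ d, ∀ e : G.edgeSet, (e : Sym2 V) ∈ w.edges → c e = d) ∨
      2 ≤ (colouredEdges c w a).ncard := by
  by_contra! hcon
  obtain ⟨hmono, hlt⟩ := hcon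
  have hle := (Set.ncard_le_one (Set.toFinite _)).1 (Nat.lt_succ_iff.1 hlt)
  obtain ⟨e, he, hea⟩ := hmono b
  have hea' : c e = a := by
    by_contra h'
    exact hea (hba _ h')
  obtain ⟨⟨x, y⟩, hxy⟩ := e
  change G.Adj x y at hxy
  refine h x y hxy hea' ?_
  -- Restricting to the edges of the cycle ensures that the detour around the deleted edge uses only
  -- edges of colour `b`.
  let H : SimpleGraph V := SimpleGraph.fromEdgeSet {e | e ∈ w.edges}
  have hwH : ∀ e ∈ w.edges, e ∈ H.edgeSet := by
    intro e he
    rw [SimpleGraph.edgeSet_fromEdgeSet]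
    exact ⟨he, G.not_isDiag_of_mem_edgeSet (w.edges_subset_edgeSet he)⟩
  have hreach := (SimpleGraph.adj_and_reachable_delete_edges_iff_exists_cycle (G := H)
    (v := x) (w := y)).2 ⟨v, w.transfer H hwH, hw.transfer hwH, by
      rw [SimpleGraph.Walk.edges_transfer]; exact he⟩
  refine hreach.2.mono ?_
  intro p q hpq
  rw [SimpleGraph.deleteEdges_adj, SimpleGraph.fromEdgeSet_adj] at hpq
  obtain ⟨⟨hmem, hpq'⟩, hnot⟩ := hpq
  have hadj : G.Adj p q := w.edges_subset_edgeSet hmem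
  refine ⟨hadj, hba _ fun hpa => hnot ?_⟩
  exact congrArg Subtype.val (hle ⟨s(p, q), hadj⟩ ⟨hmem, hpa⟩ ⟨s(x, y), hxy⟩ ⟨he, hea'⟩)

/-- A colouring is a NAC-colouring if no edge joins two vertices that are connected by edges of the
other colour. -/
lemma isNACColouring_of_not_reachable [Finite V] {c : G.edgeSet → Colour}
    (hc : Function.Surjective c)
    (hred : ∀ x y (hxy : G.Adj x y), c ⟨s(x, y), hxy⟩ = .red →
      ¬ (colourGraph c .blue).Reachable x y)
    (hblue : ∀ x y (hxy : G.Adj x y), c ⟨s(x, y), hxy⟩ = .blue →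
      ¬ (colourGraph c .red).Reachable x y) : IsNACColouring G c := by
  refine ⟨hc, fun v w hw => ?_⟩
  rcases monochromatic_or_two_le_ncard (fun _ => Colour.eq_blue_of_ne) hred hw with h1 | h1
  · exact Or.inl h1
  · rcases monochromatic_or_two_le_ncard (fun _ => Colour.eq_red_of_ne) hblue hw with h2 | h2
    · exact Or.inl h2
    · exact Or.inr ⟨h1, h2⟩

open Classical in
/-- The colouring whose red edges are those of the subgraph `K`. -/
noncomputable def subgraphColouring (K : G.Subgraph) (e : G.edgeSet) : Colour :=
  if (e : Sym2 V) ∈ K.edgeSet then .red else .blue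

lemma subgraphColouring_eq_red {K : G.Subgraph} {x y : V} (hxy : G.Adj x y) :
    subgraphColouring K ⟨s(x, y), hxy⟩ = .red ↔ K.Adj x y := by
  simp [subgraphColouring]

lemma subgraphColouring_eq_blue {K : G.Subgraph} {x y : V} (hxy : G.Adj x y) :
    subgraphColouring K ⟨s(x, y), hxy⟩ = .blue ↔ ¬ K.Adj x y := by
  simp [subgraphColouring]

lemma mem_of_reachable {H : SimpleGraph V} {U : Set V} (hH : ∀ a b, H.Adj a b → a ∈ U) {x y : V}
    (h : H.Reachable x y) (hxy : x ≠ y) : x ∈ U := by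
  obtain ⟨w⟩ := h
  cases w with
  | nil => exact absurd rfl hxy
  | cons hadj _ => exact hH _ _ hadj

/-- An edge of one side whose ends are joined within the other side has both ends in the common
vertex set, which is stable. -/
theorem IsStableSeparation.isNACColouring [Finite V] {G₁ G₂ : G.Subgraph}
    (h : IsStableSeparation G G₁ G₂) : IsNACColouring G (subgraphColouring G₁) := by
  have blue : ∀ x y (hxy : G.Adj x y), subgraphColouring G₁ ⟨s(x, y), hxy⟩ = .blue ↔
      G₂.Adj x y := by
    intro x y hxy
    rw [subgraphColouring_eq_blue, h.adj_right_iff hxy]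
  have hstable : ∀ x y, G.Adj x y → x ∈ G₁.verts → y ∈ G₁.verts → x ∈ G₂.verts → y ∈ G₂.verts →
      False := fun x y hxy hx₁ hy₁ hx₂ hy₂ => h.2 ⟨hx₁, hx₂⟩ ⟨hy₁, hy₂⟩ hxy.ne hxy
  refine isNACColouring_of_not_reachable ?_ ?_ ?_
  · rintro (_ | _)
    · obtain ⟨x, hx, -⟩ := h.1.2.1
      obtain ⟨y, hxy⟩ := h.mem_left_iff.1 hx
      exact ⟨⟨s(x, y), hxy.adj_sub⟩, (subgraphColouring_eq_red hxy.adj_sub).2 hxy⟩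
    · obtain ⟨x, hx, -⟩ := h.1.2.2
      obtain ⟨y, hxy⟩ := h.symm.mem_left_iff.1 hx
      exact ⟨⟨s(x, y), hxy.adj_sub⟩, (blue x y hxy.adj_sub).2 hxy⟩
  · intro x y hxy hc hr
    rw [subgraphColouring_eq_red] at hc
    have hU : ∀ a b, (colourGraph (subgraphColouring G₁) .blue).Adj a b → a ∈ G₂.verts := by
      rintro a b ⟨hab, hab'⟩
      exact ((blue a b hab).1 hab').fst_mem
    exact hstable x y hxy hc.fst_mem hc.snd_mem (mem_of_reachable hU hr hxy.ne)
      (mem_of_reachable hU hr.symm hxy.ne.symm)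
  · intro x y hxy hc hr
    rw [blue] at hc
    have hU : ∀ a b, (colourGraph (subgraphColouring G₁) .red).Adj a b → a ∈ G₁.verts := by
      rintro a b ⟨hab, hab'⟩
      exact ((subgraphColouring_eq_red hab).1 hab').fst_mem
    exact hstable x y hxy (mem_of_reachable hU hr hxy.ne)
      (mem_of_reachable hU hr.symm hxy.ne.symm) hc.fst_mem hc.snd_mem

instance : Finite Colour :=
  Finite.of_injective (fun a : Colour => match a with | .red => true | .blue => false) (by
    rintro (_ | _) (_ | _) h <;> simp_all)

/-- A stable separation gives two NAC-colourings. -/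
theorem numStableSeparations_le_nu [Finite V] (G : SimpleGraph V) :
    (numStableSeparations G : ℚ) ≤ nu G := by
  obtain ⟨f, hf⟩ := exists_isStableSeparation_out G
  rw [nu, numStableSeparations, le_div_iff₀ (by norm_num)]
  set 𝓢 := {P : Sym2 G.Subgraph | ∃ G₁ G₂ : G.Subgraph, P = s(G₁, G₂) ∧
    IsStableSeparation G G₁ G₂} with h𝓢
  -- The Boolean chooses which side is red; the sides differ, so each separation gives two distinct
  -- colourings.
  let κ : Sym2 G.Subgraph × Bool → G.Subgraph × G.Subgraph := fun x =>
    if x.2 then f x.1 else (f x.1).swap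
  have hκ : ∀ x ∈ 𝓢 ×ˢ (Set.univ : Set Bool), x.1 = s((κ x).1, (κ x).2) ∧
      IsStableSeparation G (κ x).1 (κ x).2 := by
    rintro ⟨P, b⟩ ⟨hP, -⟩
    cases b
    · simp only [κ, Bool.false_eq_true, if_false, Prod.fst_swap, Prod.snd_swap]
      exact ⟨(hf P hP).1.trans Sym2.eq_swap, (hf P hP).2.symm⟩
    · simp only [κ, if_true]
      exact hf P hP
  have hmain : (𝓢 ×ˢ (Set.univ : Set Bool)).ncard ≤
      {c : G.edgeSet → Colour | IsNACColouring G c}.ncard := by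
    refine Set.ncard_le_ncard_of_injOn (fun x => subgraphColouring (κ x).1)
      (fun x hx => (hκ x hx).2.isNACColouring) ?_ (Set.toFinite _)
    rintro x hx y hy hxy
    have hpair := (hκ x hx).2.ext (hκ y hy).2 fun a b hab => by
      rw [← subgraphColouring_eq_red hab, ← subgraphColouring_eq_red hab]
      exact ⟨fun h => (congrFun hxy _).symm.trans h, fun h => (congrFun hxy _).trans h⟩
    have h1 : x.1 = y.1 := by rw [(hκ x hx).1, (hκ y hy).1, hpair.1, hpair.2]
    obtain ⟨P, b⟩ := x
    obtain ⟨Q, d⟩ := y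
    obtain rfl : P = Q := h1
    have hne := (hf P hx.1).2.ne
    cases b <;> cases d
    · rfl
    · exact absurd hpair.2 (by simpa [κ] using hne)
    · exact absurd hpair.1 (by simpa [κ] using hne)
    · rfl
  rw [Set.ncard_prod, Set.ncard_univ, Nat.card_eq_fintype_card, Fintype.card_bool] at hmain
  exact_mod_cast hmain

end NACColourings

/-! ### Colourings of a system of four bodies. -/

section FourBodies

open Finset

variable {V : Type*} [DecidableEq V] {G : SimpleGraph V} {𝓑 : Finset (Finset V)}

/-- Two adjacent vertices of a body are not connected within two other bodies. -/
lemma IsBodySystem.not_reachable (h𝓑 : IsBodySystem G 𝓑) {R B D : Finset V} (hR : R ∈ 𝓑)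
    (hB : B ∈ 𝓑) (hD : D ∈ 𝓑) (hRB : R ≠ B) (hRD : R ≠ D) {H : SimpleGraph V}
    (hH : ∀ a b, H.Adj a b → (a ∈ B ∧ b ∈ B) ∨ (a ∈ D ∧ b ∈ D)) {x y : V} (hxy : x ≠ y)
    (hx : x ∈ R) (hy : y ∈ R) : ¬ H.Reachable x y := by
  intro hreach
  have main : ∀ B D : Finset V, B ∈ 𝓑 → D ∈ 𝓑 → R ≠ B → R ≠ D →
      (∀ a b, H.Adj a b → (a ∈ B ∧ b ∈ B) ∨ (a ∈ D ∧ b ∈ D)) → x ∈ B → False := by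
    intro B D hB hD hRB hRD hH hxB
    have hyB : y ∉ B := fun hyB => hRB (h𝓑.eq_of_mem hR hB hxy hx hy hxB hyB)
    have hyD : y ∈ D := by
      rcases mem_of_reachable (U := {v | v ∈ B ∨ v ∈ D})
        (fun a b hab => (hH a b hab).imp And.left And.left) hreach.symm hxy.symm with h | h
      · exact absurd h hyB
      · exact h
    have hxD : x ∉ D := fun hxD => hRD (h𝓑.eq_of_mem hR hD hxy hx hy hxD hyD)
    obtain ⟨w⟩ := hreach
    -- The walk leaves `B` along an edge of `D`, so it passes through a common vertex of `B` and
    -- `D`, and `R`, `B`, `D` would form a triangle.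
    obtain ⟨d, -, hd1, hd2⟩ := w.exists_boundary_dart (B : Set V) hxB hyB
    have hz : d.fst ∈ D := by
      rcases hH _ _ d.adj with h | h
      · exact absurd h.2 hd2
      · exact h.1
    exact hRD (h𝓑.no_triangle hR hB hD hxy (z := d.fst)
      (fun h => hyB (h ▸ hd1)) hx hxB hy hyD hd1 hz hRB)
  rcases mem_of_reachable (U := {v | v ∈ B ∨ v ∈ D})
    (fun a b hab => (hH a b hab).imp And.left And.left) hreach hxy with h | h
  · exact main B D hB hD hRB hRD hH h
  · exact main D B hD hB hRD hRB (fun a b hab => (hH a b hab).symm) h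

open Classical in
/-- The colouring in which the edges of the bodies in `s` are red. -/
noncomputable def bodyColouring (G : SimpleGraph V) (s : Finset (Finset V)) (e : G.edgeSet) :
    Colour :=
  if ∃ B ∈ s, ∀ x ∈ (e : Sym2 V), x ∈ B then .red else .blue

lemma IsBodySystem.bodyColouring_eq_red (h𝓑 : IsBodySystem G 𝓑) {s : Finset (Finset V)}
    (hs : s ⊆ 𝓑) {B : Finset V} (hB : B ∈ 𝓑) {x y : V} (hxy : G.Adj x y) (hx : x ∈ B)
    (hy : y ∈ B) : bodyColouring G s ⟨s(x, y), hxy⟩ = .red ↔ B ∈ s := by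
  have : (∃ C ∈ s, ∀ v ∈ s(x, y), v ∈ C) ↔ B ∈ s := by
    constructor
    · rintro ⟨C, hC, h⟩
      rwa [h𝓑.eq_of_mem hB (hs hC) hxy.ne hx hy (h x (by simp)) (h y (by simp))]
    · intro h
      refine ⟨B, h, fun v hv => ?_⟩
      rcases Sym2.mem_iff.1 hv with rfl | rfl <;> assumption
  rw [← this, bodyColouring]
  simp

/-- With two bodies of each colour, an almost monochromatic cycle would join two vertices of a body
through just two other bodies, which `IsBodySystem.not_reachable` excludes. -/
lemma IsBodySystem.isNACColouring [Finite V] (h𝓑 : IsBodySystem G 𝓑) (h4 : #𝓑 = 4)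
    {s : Finset (Finset V)} (hs : s ⊆ 𝓑) (hs2 : #s = 2) :
    IsNACColouring G (bodyColouring G s) := by
  have hs2' : #(𝓑 \ s) = 2 := by rw [card_sdiff_of_subset hs, h4, hs2]
  have blue : ∀ {B : Finset V}, B ∈ 𝓑 → ∀ {x y : V} (hxy : G.Adj x y), x ∈ B → y ∈ B →
      (bodyColouring G s ⟨s(x, y), hxy⟩ = .blue ↔ B ∉ s) := by
    intro B hB x y hxy hx hy
    rw [← h𝓑.bodyColouring_eq_red hs hB hxy hx hy]
    exact ⟨fun h h' => (by simp [h] at h'), fun h => Colour.eq_blue_of_ne h⟩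
  have key : ∀ t ⊆ 𝓑, #t = 2 → ∀ R ∈ 𝓑, R ∉ t → ∀ {H : SimpleGraph V},
      (∀ a b, H.Adj a b → ∃ B ∈ t, a ∈ B ∧ b ∈ B) → ∀ {x y}, x ≠ y → x ∈ R → y ∈ R →
      ¬ H.Reachable x y := by
    intro t ht ht2 R hR hRt H hH x y hxy hx hy
    obtain ⟨B, D, -, rfl⟩ := card_eq_two.1 ht2
    simp only [mem_insert, mem_singleton, not_or] at hRt
    refine h𝓑.not_reachable hR (ht (by simp)) (ht (by simp)) hRt.1 hRt.2 (fun a b hab => ?_)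
      hxy hx hy
    simpa using hH a b hab
  refine isNACColouring_of_not_reachable ?_ ?_ ?_
  · rintro (_ | _)
    · obtain ⟨B, hB⟩ := card_pos.1 (by omega : 0 < #s)
      obtain ⟨a, ha, b, hb, hab⟩ := h𝓑.exists_adj B (hs hB)
      exact ⟨⟨s(a, b), hab⟩, (h𝓑.bodyColouring_eq_red hs (hs hB) hab ha hb).2 hB⟩
    · obtain ⟨B, hB⟩ := card_pos.1 (by omega : 0 < #(𝓑 \ s))
      rw [mem_sdiff] at hB
      obtain ⟨a, ha, b, hb, hab⟩ := h𝓑.exists_adj B hB.1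
      exact ⟨⟨s(a, b), hab⟩, (blue hB.1 hab ha hb).2 hB.2⟩
  · intro x y hxy hc
    obtain ⟨R, hR, hx, hy⟩ := h𝓑.exists_mem x y hxy
    rw [h𝓑.bodyColouring_eq_red hs hR hxy hx hy] at hc
    refine key (𝓑 \ s) sdiff_subset hs2' R hR (fun h => (mem_sdiff.1 h).2 hc) ?_ hxy.ne hx hy
    rintro a b ⟨hab, hab'⟩
    obtain ⟨B, hB, ha, hb⟩ := h𝓑.exists_mem a b hab
    exact ⟨B, mem_sdiff.2 ⟨hB, (blue hB hab ha hb).1 hab'⟩, ha, hb⟩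
  · intro x y hxy hc
    obtain ⟨R, hR, hx, hy⟩ := h𝓑.exists_mem x y hxy
    rw [blue hR hxy hx hy] at hc
    refine key s hs hs2 R hR hc ?_ hxy.ne hx hy
    rintro a b ⟨hab, hab'⟩
    obtain ⟨B, hB, ha, hb⟩ := h𝓑.exists_mem a b hab
    exact ⟨B, (h𝓑.bodyColouring_eq_red hs hB hab ha hb).1 hab', ha, hb⟩

/-- Four bodies give six NAC-colourings. -/
lemma IsBodySystem.three_le_nu [Finite V] (h𝓑 : IsBodySystem G 𝓑) (h4 : #𝓑 = 4) :
    3 ≤ nu G := by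
  have h6 : #(powersetCard 2 𝓑) = 6 := by
    rw [card_powersetCard, h4]
    rfl
  have h : (powersetCard 2 𝓑 : Set (Finset (Finset V))).ncard ≤
      {c : G.edgeSet → Colour | IsNACColouring G c}.ncard := by
    refine Set.ncard_le_ncard_of_injOn (bodyColouring G) ?_ ?_ (Set.toFinite _)
    · intro s hs
      rw [mem_coe, mem_powersetCard] at hs
      exact h𝓑.isNACColouring h4 hs.1 hs.2
    · intro s hs t ht hst
      rw [mem_coe, mem_powersetCard] at hs ht
      ext B
      by_cases hB : B ∈ 𝓑
      · obtain ⟨a, ha, b, hb, hab⟩ := h𝓑.exists_adj B hB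
        rw [← h𝓑.bodyColouring_eq_red hs.1 hB hab ha hb,
          ← h𝓑.bodyColouring_eq_red ht.1 hB hab ha hb, hst]
      · exact ⟨fun h => absurd (hs.1 h) hB, fun h => absurd (ht.1 h) hB⟩
  rw [Set.ncard_coe_finset, h6] at h
  rw [nu, le_div_iff₀ (by norm_num)]
  norm_num
  exact_mod_cast h

end FourBodies

/-! ### A 2-connected flexible graph has at least four bodies. -/

section TwoConnected

variable {V : Type*} {G : SimpleGraph V}

lemma exists_adj_of_preconnected (hG : G.Preconnected) {U : Set V} {x y : V} (hx : x ∈ U)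
    (hy : y ∉ U) : ∃ a ∈ U, ∃ b, b ∉ U ∧ G.Adj a b := by
  obtain ⟨w⟩ := hG x y
  obtain ⟨d, -, h1, h2⟩ := w.exists_boundary_dart U hx hy
  exact ⟨d.fst, h1, d.snd, h2, d.adj⟩

lemma IsTwoConnected.exists_adj [Finite V] (h : IsTwoConnected G) (v : V) : ∃ w, G.Adj v w := by
  have : Nontrivial V := (Finite.one_lt_card_iff_nontrivial).1 (by have := h.three_le_card; omega)
  obtain ⟨y, hy⟩ := exists_ne v
  obtain ⟨a, ha, b, -, hab⟩ := exists_adj_of_preconnected h.connected.preconnected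
    (U := {v}) (x := v) (y := y) rfl hy
  obtain rfl : a = v := ha
  exact ⟨b, hab⟩

open Finset

variable [DecidableEq V] {𝓑 : Finset (Finset V)}

/-- A body of a 2-connected graph shares two vertices with other bodies. -/
lemma IsBodySystem.exists_junction [Fintype V] (h𝓑 : IsBodySystem G 𝓑) (h2 : IsTwoConnected G)
    (huniv : univ ∉ 𝓑) {B : Finset V} (hB : B ∈ 𝓑) (v : V) :
    ∃ a ∈ B, a ≠ v ∧ ∃ C ∈ 𝓑, C ≠ B ∧ a ∈ C := by
  obtain ⟨y, hy⟩ : ∃ y, y ∉ B := by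
    by_contra! hcon
    exact huniv ((eq_univ_iff_forall.2 hcon) ▸ hB)
  have hfin : ∀ a b, G.Adj a b → a ∈ B → b ∉ B → a ≠ v →
      ∃ a ∈ B, a ≠ v ∧ ∃ C ∈ 𝓑, C ≠ B ∧ a ∈ C := by
    intro a b hab ha hb hav
    obtain ⟨C, hC, haC, hbC⟩ := h𝓑.exists_mem a b hab
    exact ⟨a, ha, hav, C, hC, fun e => hb (e ▸ hbC), haC⟩
  by_cases hvB : v ∈ B
  · obtain ⟨x, hx, hxv⟩ := exists_mem_ne (h𝓑.two_le_card B hB) v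
    have hyv : y ≠ v := fun e => hy (e ▸ hvB)
    -- After deletion of `v` some edge still leaves `B`, and the body around that edge is a
    -- different one.
    obtain ⟨a, ha, b, hb, hab⟩ := exists_adj_of_preconnected (h2.connected_delete v).preconnected
      (U := {z | (z : V) ∈ B}) (x := ⟨x, hxv⟩) (y := ⟨y, hyv⟩) hx hy
    exact hfin a b hab ha hb a.2
  · obtain ⟨x, hx⟩ := card_pos.1 (by have := h𝓑.two_le_card B hB; omega : 0 < #B)
    obtain ⟨a, ha, b, hb, hab⟩ := exists_adj_of_preconnected h2.connected.preconnected
      (U := (B : Set V)) hx hy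
    exact hfin a b hab ha hb fun e => hvB (e ▸ ha)

/-- Leave `R₁` at two junctions `x` and `y` into `R₂` and `R₃`, then leave `R₂` at a junction other
than `x` into `R₄`. A coincidence among these would produce two bodies with two common vertices or a
triangle of bodies. -/
lemma IsBodySystem.four_le_card [Fintype V] (h𝓑 : IsBodySystem G 𝓑) (h2 : IsTwoConnected G)
    (huniv : univ ∉ 𝓑) : 4 ≤ #𝓑 := by
  obtain ⟨v⟩ := h2.connected.nonempty
  obtain ⟨w, hvw⟩ := h2.exists_adj v
  obtain ⟨R₁, hR₁, -⟩ := h𝓑.exists_mem v w hvw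
  obtain ⟨x, hx₁, -, R₂, hR₂, h21, hx₂⟩ := h𝓑.exists_junction h2 huniv hR₁ v
  obtain ⟨y, hy₁, hyx, R₃, hR₃, h31, hy₃⟩ := h𝓑.exists_junction h2 huniv hR₁ x
  obtain ⟨z, hz₂, hzx, R₄, hR₄, h42, hz₄⟩ := h𝓑.exists_junction h2 huniv hR₂ x
  have h23 : R₂ ≠ R₃ := fun e =>
    h21 (h𝓑.eq_of_mem hR₂ hR₁ hyx (e ▸ hy₃) hx₂ hy₁ hx₁)
  have h41 : R₄ ≠ R₁ := fun e =>
    h42 (h𝓑.eq_of_mem hR₄ hR₂ hzx hz₄ (e ▸ hx₁) hz₂ hx₂)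
  have h43 : R₄ ≠ R₃ := by
    rintro rfl
    refine h41 (h𝓑.no_triangle hR₁ hR₂ hR₄ hyx.symm (z := z) ?_ hx₁ hx₂ hy₁ hy₃ hz₂ hz₄
      h21.symm).symm
    rintro rfl
    exact h21 (h𝓑.eq_of_mem hR₂ hR₁ hyx hz₂ hx₂ hy₁ hx₁)
  rw [show 4 = #{R₁, R₂, R₃, R₄} by
    rw [card_insert_of_notMem (by simp [h21.symm, h31.symm, h41.symm]),
      card_insert_of_notMem (by simp [h23, h42.symm]), card_pair h43.symm]]
  exact card_le_card (by simp [insert_subset_iff, *])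

end TwoConnected

end FlexGraph

theorem lemma5p8 {V : Type*} [Finite V] (G : SimpleGraph V)
    (h2 : FlexGraph.IsTwoConnected G) (hflex : FlexGraph.IsFlexible G) :
    ⌈Real.logb 2 (FlexGraph.numRigidComponents G : ℝ)⌉₊ ≤ FlexGraph.numStableSeparations G ∧
    ((⌈Real.logb 2 (FlexGraph.numRigidComponents G : ℝ)⌉₊ : ℕ) : ℚ) ≤ FlexGraph.nu G ∧
    3 ≤ FlexGraph.nu G := by
  classical
  have := Fintype.ofFinite V
  obtain ⟨𝓑, h𝓑, huniv⟩ := FlexGraph.exists_isBodySystem G hflex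
  have := h2.connected.nonempty
  have hpow := h𝓑.card_le_two_pow h2.exists_adj
  have hcomp := h𝓑.numRigidComponents_le h2.exists_adj hflex
  have hnu := FlexGraph.numStableSeparations_le_nu G
  have hlog : ⌈Real.logb 2 (FlexGraph.numRigidComponents G : ℝ)⌉₊ ≤
      FlexGraph.numStableSeparations G := by
    rw [Nat.ceil_le]
    -- The value 0 is treated apart because the comparison of `Real.logb` with a power needs a
    -- positive argument; there `Real.logb 2 0 = 0`.
    rcases Nat.eq_zero_or_pos (FlexGraph.numRigidComponents G) with h0 | h0
    · simp [h0]
    · rw [Real.logb_le_iff_le_rpow (by norm_num) (by exact_mod_cast h0), Real.rpow_natCast]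
      exact_mod_cast hcomp.trans hpow
  refine ⟨hlog, le_trans (by exact_mod_cast hlog) hnu, ?_⟩
  -- Four bodies guarantee only two separations, so they need the direct count of colourings; five
  -- bodies exceed `2 ^ 2` and force a third separation.
  rcases (h𝓑.four_le_card h2 huniv).eq_or_lt with h4 | h4
  · exact h𝓑.three_le_nu h4.symm
  · refine le_trans ?_ hnu
    have h3 : 3 ≤ FlexGraph.numStableSeparations G := by
      by_contra! hlt
      have := Nat.pow_le_pow_right (n := 2) (by norm_num) (Nat.le_of_lt_succ hlt)
      omega
    exact_mod_cast h3
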